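/- Let $X, X_1, X_2, \ldots$ be i.i.d. real random variables with $E|X|<\infty$ and $EX<0$; put $M=\sup_{n\ge 0}(X_1+\cdots+X_n)$ (the empty sum being $0$). Assume that $X^+=\max(X,0)$ belongs to the class $\mathcal S^*$, that is, $P(X>t)>0$ for all $t$ and $$2\,E X^+\,P(X>t)\sim\int_0^t P(X>t-s)\,P(X>s)\,ds\qquad (t\to\infty).$$ Let $Z\ge 0$ be a random variable independent of $X$ with $P(Z>t)=\min\bigl[-(EX)^{-1}\int_t^\infty P(X>s)\,ds,\,1\bigr]$ for $t>0$, and put $v(y)=P(Z>-y)$ and $w(y)=E\,v(y+X)=P(X+Z>-y)$ for $y\in\mathbb R$. Fix $\gamma\in(0,1)$ and let $a_*\le 0$ be any number such that $$-\gamma\le\frac{v(y)^2-w(y)^2}{P(X>-y)\,w(y)}\qquad\text{for all } y\le a_*.$$ Let $E_y^{Q_{a_*}}$ denote expectation under which $(S_n)_{n\ge0}$ is the Markov chain on $\mathbb R$ with $S_0=y$ and transition kernel $Q_{a_*}(y,dz)=P(y+X\in dz)\,v(z+a_*)/w(y+a_*)$. Let $\tau(0)=\inf\{n\ge0:S_n>0\}$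 and $$R=I(\tau(0)<\infty)\prod_{k=1}^{\tau(0)}\frac{w(S_{k-1}+a_*)}{v(S_k+a_*)}.$$ Then $\kappa(a_*):=\inf_{z\ge0}v(z+a_*)=P(Z>-a_*)>0$, and for every $y\le 0$ $$E_y^{Q_{a_*}}R^2\le(1-\gamma)^{-1}\kappa(a_*)^{-2}\,v(y+a_*)^2.$$ Consequently the estimator $R(b)$, defined as $R$ simulated from $S_0=-b$, is strongly efficient for $P(M>b)$: it is unbiased, $E_{-b}^{Q_{a_*}}R(b)=P(M>b)$ for all $b>0$, and $$\sup_{b>0}\frac{E_{-b}^{Q_{a_*}}R(b)^2}{P(M>b)^2}<\infty.$$ -/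

import Mathlib

open MeasureTheory ProbabilityTheory

namespace TailIS

/-- The tail `t ↦ ν (t, ∞)` of a law on the real line. -/
noncomputable def tail (ν : Measure ℝ) (t : ℝ) : ℝ := ν.real (Set.Ioi t)

/-- The law of `X⁺ = max (X, 0)` when `X` has law `μ`. -/
noncomputable def posPartLaw (μ : Measure ℝ) : Measure ℝ := μ.map (fun x => max x 0)

/-- The class `S*` of laws of nonnegative random variables `Z`: the mean `E Z` is finite, the tail
is everywhere positive (so that `∼` below is a statement about a ratio tending to one) and
`2 E Z P(Z > t) ∼ ∫₀ᵗ P(Z > t - s) P(Z > s) ds` as `t → ∞`. -/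
structure ClassSStar (ν : Measure ℝ) : Prop where
  nonneg : ν (Set.Iio 0) = 0
  integrable : Integrable (fun z : ℝ => z) ν
  tail_pos : ∀ t : ℝ, 0 < tail ν t
  equivalent : Asymptotics.IsEquivalent Filter.atTop
    (fun t : ℝ => 2 * (∫ z, z ∂ν) * tail ν t)
    (fun t : ℝ => ∫ s in (0 : ℝ)..t, tail ν (t - s) * tail ν s)

/-- `|E X|⁻¹ ∫_t^∞ P(X > s) ds`. -/
noncomputable def integratedTail (μ : Measure ℝ) (t : ℝ) : ℝ :=
  |∫ x, x ∂μ|⁻¹ * ∫ s in Set.Ioi t, tail μ s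

/-- The distribution function of `Z`: it vanishes on `(-∞, 0)` and equals
`1 - min (|E X|⁻¹ ∫_t^∞ P(X > s) ds) 1` for `t ≥ 0`. -/
noncomputable def zCdfFun (μ : Measure ℝ) (t : ℝ) : ℝ :=
  if t < 0 then 0 else 1 - min (integratedTail μ t) 1

lemma tail_nonneg (μ : Measure ℝ) (t : ℝ) : 0 ≤ tail μ t := measureReal_nonneg

lemma antitone_tail (μ : Measure ℝ) [IsFiniteMeasure μ] : Antitone (tail μ) :=
  fun _ _ h => measureReal_mono (Set.Ioi_subset_Ioi h)

lemma integratedTail_nonneg (μ : Measure ℝ) (t : ℝ) : 0 ≤ integratedTail μ t :=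
  mul_nonneg (inv_nonneg.2 (abs_nonneg _))
    (integral_nonneg fun s => tail_nonneg μ s)

lemma intervalIntegrable_tail (μ : Measure ℝ) [IsFiniteMeasure μ] (a b : ℝ) :
    IntervalIntegrable (tail μ) volume a b :=
  (antitone_tail μ).intervalIntegrable

/-- Integrability of the tail near infinity does not depend on the left end point. -/
lemma integrableOn_tail_Ioi (μ : Measure ℝ) [IsFiniteMeasure μ] {a : ℝ}
    (h : IntegrableOn (tail μ) (Set.Ioi a)) (b : ℝ) : IntegrableOn (tail μ) (Set.Ioi b) := by
  rcases le_total a b with hab | hab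
  · exact h.mono_set (Set.Ioi_subset_Ioi hab)
  · rw [← Set.Ioc_union_Ioi_eq_Ioi hab]
    exact ((intervalIntegrable_iff_integrableOn_Ioc_of_le hab).1
      (intervalIntegrable_tail μ b a)).union h

lemma integral_tail_eq (μ : Measure ℝ) [IsFiniteMeasure μ]
    (h : IntegrableOn (tail μ) (Set.Ioi 0)) (t : ℝ) :
    ∫ s in Set.Ioi t, tail μ s = (∫ s in Set.Ioi 0, tail μ s) - ∫ s in (0 : ℝ)..t, tail μ s := by
  have := intervalIntegral.integral_Ioi_sub_Ioi' h (integrableOn_tail_Ioi μ h t)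
  linarith

lemma integratedTail_eq_zero (μ : Measure ℝ) [IsFiniteMeasure μ]
    (h : ¬ IntegrableOn (tail μ) (Set.Ioi 0)) (t : ℝ) : integratedTail μ t = 0 := by
  have : ¬ IntegrableOn (tail μ) (Set.Ioi t) := fun h' => h (integrableOn_tail_Ioi μ h' 0)
  rw [integratedTail, integral_undef this, mul_zero]

lemma continuous_integratedTail (μ : Measure ℝ) [IsFiniteMeasure μ] :
    Continuous (integratedTail μ) := by
  by_cases h : IntegrableOn (tail μ) (Set.Ioi 0)
  · have h1 : integratedTail μ = fun t => |∫ x, x ∂μ|⁻¹ *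
        ((∫ s in Set.Ioi 0, tail μ s) - ∫ s in (0 : ℝ)..t, tail μ s) := by
      funext t
      rw [integratedTail, integral_tail_eq μ h t]
    rw [h1]
    exact continuous_const.mul (continuous_const.sub
      (intervalIntegral.continuous_primitive (intervalIntegrable_tail μ) 0))
  · have h1 : integratedTail μ = fun _ => 0 := funext (integratedTail_eq_zero μ h)
    rw [h1]
    exact continuous_const

lemma antitone_integratedTail (μ : Measure ℝ) [IsFiniteMeasure μ] :
    Antitone (integratedTail μ) := by
  intro s t hst
  by_cases h : IntegrableOn (tail μ) (Set.Ioi 0)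
  · exact mul_le_mul_of_nonneg_left
      (setIntegral_mono_set (integrableOn_tail_Ioi μ h s)
        (Filter.Eventually.of_forall fun x => tail_nonneg μ x)
        (Set.Ioi_subset_Ioi hst).eventuallyLE) (inv_nonneg.2 (abs_nonneg _))
  · rw [integratedTail_eq_zero μ h, integratedTail_eq_zero μ h]

lemma zCdfFun_nonneg (μ : Measure ℝ) (t : ℝ) : 0 ≤ zCdfFun μ t := by
  unfold zCdfFun
  split_ifs
  · exact le_rfl
  · linarith [min_le_right (integratedTail μ t) 1]

lemma zCdfFun_le_one (μ : Measure ℝ) (t : ℝ) : zCdfFun μ t ≤ 1 := by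
  unfold zCdfFun
  split_ifs
  · exact zero_le_one
  · linarith [le_min (integratedTail_nonneg μ t) zero_le_one]

lemma monotone_zCdfFun (μ : Measure ℝ) [IsFiniteMeasure μ] : Monotone (zCdfFun μ) := by
  intro s t hst
  by_cases hs : s < 0
  · have : zCdfFun μ s = 0 := if_pos hs
    rw [this]
    exact zCdfFun_nonneg μ t
  · have ht : ¬ t < 0 := by linarith [not_lt.1 hs]
    have h1 := antitone_integratedTail μ hst
    have h2 : min (integratedTail μ t) 1 ≤ min (integratedTail μ s) 1 := min_le_min_right 1 h1
    simp only [zCdfFun, if_neg hs, if_neg ht]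
    linarith

/-- The distribution function of `Z` as a Stieltjes function. -/
noncomputable def zCdf (μ : Measure ℝ) [IsFiniteMeasure μ] : StieltjesFunction ℝ where
  toFun := zCdfFun μ
  mono' := monotone_zCdfFun μ
  right_continuous' := by
    intro x
    by_cases hx : x < 0
    · have : zCdfFun μ =ᶠ[nhds x] fun _ => 0 := by
        filter_upwards [Iio_mem_nhds hx] with y hy
        exact if_pos hy
      exact (continuousAt_const.congr this.symm).continuousWithinAt
    · have hc : ContinuousWithinAt (fun t => 1 - min (integratedTail μ t) 1) (Set.Ici x) x :=
        (continuous_const.sub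
          ((continuous_integratedTail μ).min continuous_const)).continuousWithinAt
      refine hc.congr (fun y hy => ?_) (if_neg hx)
      exact if_neg (not_lt.2 ((not_lt.1 hx).trans hy))

/-- The law of the nonnegative random variable `Z` with
`P(Z > t) = min (-(E X)⁻¹ ∫_t^∞ P(X > s) ds) 1` for `t > 0`. -/
noncomputable def zLaw (μ : Measure ℝ) [IsFiniteMeasure μ] : Measure ℝ := (zCdf μ).measure

/-- `v y = P(Z > -y)`. -/
noncomputable def v (μ : Measure ℝ) [IsFiniteMeasure μ] (y : ℝ) : ℝ :=
  (zLaw μ).real {z | -y < z}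

/-- `w y = P(X + Z > -y)` with `X` and `Z` independent. -/
noncomputable def w (μ : Measure ℝ) [IsFiniteMeasure μ] (y : ℝ) : ℝ :=
  (μ.prod (zLaw μ)).real {p | -y < p.1 + p.2}

/-- `κ(a) = inf_{z ≥ 0} v (z + a)`. -/
noncomputable def kappa (μ : Measure ℝ) [IsFiniteMeasure μ] (a : ℝ) : ℝ :=
  ⨅ z : Set.Ici (0 : ℝ), v μ (z + a)

lemma tendsto_zCdf_atBot (μ : Measure ℝ) [IsFiniteMeasure μ] :
    Filter.Tendsto (zCdf μ) Filter.atBot (nhds 0) := by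
  refine tendsto_const_nhds.congr' ?_
  filter_upwards [Filter.Iio_mem_atBot (0 : ℝ)] with t ht
  exact (if_pos ht).symm

lemma exists_tendsto_zCdf_atTop (μ : Measure ℝ) [IsFiniteMeasure μ] :
    ∃ l : ℝ, Filter.Tendsto (zCdf μ) Filter.atTop (nhds l) :=
  ⟨_, tendsto_atTop_ciSup (zCdf μ).mono
    ⟨1, by rintro _ ⟨t, rfl⟩; exact zCdfFun_le_one μ t⟩⟩

instance instIsFiniteMeasure_zLaw (μ : Measure ℝ) [IsFiniteMeasure μ] :
    IsFiniteMeasure (zLaw μ) := by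
  obtain ⟨l, hl⟩ := exists_tendsto_zCdf_atTop μ
  exact ⟨by
    rw [zLaw, (zCdf μ).measure_univ (tendsto_zCdf_atBot μ) hl]
    exact ENNReal.ofReal_lt_top⟩

section Check

variable (μ : Measure ℝ) [IsProbabilityMeasure μ]

lemma integrableOn_tail (hint : Integrable (fun x : ℝ => x) μ) :
    IntegrableOn (tail μ) (Set.Ioi 0) := by
  have hp : Integrable (fun x : ℝ => max x 0) μ := hint.pos_part
  have h1 := lintegral_eq_lintegral_meas_lt μ
    (Filter.Eventually.of_forall fun x : ℝ => le_max_right x 0) hp.aemeasurable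
  have h2 : ∫⁻ t in Set.Ioi (0 : ℝ), μ {x : ℝ | t < max x 0} < ⊤ := by
    rw [← h1, ← ofReal_integral_eq_lintegral_ofReal hp
      (Filter.Eventually.of_forall fun x : ℝ => le_max_right x 0)]
    exact ENNReal.ofReal_lt_top
  refine ⟨(antitone_tail μ).measurable.aestronglyMeasurable, ?_⟩
  rw [hasFiniteIntegral_iff_ofReal (Filter.Eventually.of_forall fun x => tail_nonneg μ x)]
  refine lt_of_le_of_lt (setLIntegral_mono' measurableSet_Ioi fun t ht => ?_) h2
  rw [tail, Measure.real, ENNReal.ofReal_toReal (measure_ne_top _ _)]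
  exact measure_mono fun x (hx : t < x) => lt_of_lt_of_le hx (le_max_left x 0)

lemma tendsto_zCdf_atTop (hint : Integrable (fun x : ℝ => x) μ) :
    Filter.Tendsto (zCdf μ) Filter.atTop (nhds 1) := by
  have hi := integrableOn_tail μ hint
  have h1 : Filter.Tendsto (integratedTail μ) Filter.atTop (nhds 0) := by
    have h2 := intervalIntegral_tendsto_integral_Ioi 0 hi Filter.tendsto_id
    have h3 := (tendsto_const_nhds (x := ∫ s in Set.Ioi 0, tail μ s)).sub h2
    have h4 := h3.const_mul |∫ x, x ∂μ|⁻¹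
    rw [sub_self, mul_zero] at h4
    refine h4.congr fun t => ?_
    rw [integratedTail, integral_tail_eq μ hi t]
    rfl
  have h5 : Filter.Tendsto (fun t => 1 - min (integratedTail μ t) 1) Filter.atTop (nhds 1) := by
    have := (tendsto_const_nhds (x := (1 : ℝ))).sub
      (h1.min (tendsto_const_nhds (x := (1 : ℝ))))
    simpa using this
  refine h5.congr' ?_
  filter_upwards [Filter.Ici_mem_atTop (0 : ℝ)] with t ht
  exact (if_neg (not_lt.2 ht)).symm

/-- `zLaw μ` is a probability measure as soon as `X` is integrable. -/
theorem isProbabilityMeasure_zLaw (hint : Integrable (fun x : ℝ => x) μ) :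
    IsProbabilityMeasure (zLaw μ) :=
  ⟨by rw [zLaw, (zCdf μ).measure_univ (tendsto_zCdf_atBot μ) (tendsto_zCdf_atTop μ hint)]; simp⟩

/-- `zLaw μ` has the prescribed tail. -/
theorem tail_zLaw (hint : Integrable (fun x : ℝ => x) μ) (hneg : ∫ x, x ∂μ < 0) {t : ℝ}
    (ht : 0 ≤ t) :
    tail (zLaw μ) t = min (-(∫ x, x ∂μ)⁻¹ * ∫ s in Set.Ioi t, tail μ s) 1 := by
  have h1 : zCdf μ t = 1 - min (integratedTail μ t) 1 := if_neg (not_lt.2 ht)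
  have h2 : integratedTail μ t = -(∫ x, x ∂μ)⁻¹ * ∫ s in Set.Ioi t, tail μ s := by
    rw [integratedTail, abs_of_neg hneg, inv_neg]
  rw [tail, Measure.real, zLaw, (zCdf μ).measure_Ioi (tendsto_zCdf_atTop μ hint), h1, ← h2,
    sub_sub_cancel, ENNReal.toReal_ofReal (le_min (integratedTail_nonneg μ t) zero_le_one)]

/-- `zLaw μ` is carried by `[0, ∞)`. -/
theorem zLaw_Iio : zLaw μ (Set.Iio 0) = 0 := by
  have : Set.Iio (0 : ℝ) = ⋃ n : ℕ, Set.Iic (-(1 / ((n : ℝ) + 1))) := by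
    ext x
    simp only [Set.mem_Iio, Set.mem_iUnion, Set.mem_Iic]
    constructor
    · intro hx
      obtain ⟨n, hn⟩ := exists_nat_one_div_lt (neg_pos.2 hx)
      exact ⟨n, by linarith⟩
    · rintro ⟨n, hn⟩
      have : (0 : ℝ) < 1 / ((n : ℝ) + 1) := Nat.one_div_pos_of_nat
      linarith
  rw [this, measure_iUnion_null_iff]
  intro n
  have hn : -(1 / ((n : ℝ) + 1)) < 0 := neg_neg_iff_pos.2 Nat.one_div_pos_of_nat
  have h0 : zCdf μ (-(1 / ((n : ℝ) + 1))) = 0 := if_pos hn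
  rw [zLaw, (zCdf μ).measure_Iic (tendsto_zCdf_atBot μ), h0]
  simp

end Check

lemma monotone_v (μ : Measure ℝ) [IsFiniteMeasure μ] : Monotone (v μ) :=
  fun _ _ h => measureReal_mono fun z (hz : _ < z) =>
    lt_of_le_of_lt (neg_le_neg h) hz

lemma monotone_w (μ : Measure ℝ) [IsFiniteMeasure μ] : Monotone (w μ) :=
  fun _ _ h => measureReal_mono fun z (hz : _ < z.1 + z.2) =>
    lt_of_le_of_lt (neg_le_neg h) hz

lemma v_nonneg (μ : Measure ℝ) [IsFiniteMeasure μ] (y : ℝ) : 0 ≤ v μ y := measureReal_nonneg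

lemma w_nonneg (μ : Measure ℝ) [IsFiniteMeasure μ] (y : ℝ) : 0 ≤ w μ y := measureReal_nonneg

/-- `w y = E v (y + X)`. -/
lemma lintegral_v (μ : Measure ℝ) [IsFiniteMeasure μ] (y : ℝ) :
    ∫⁻ x, ENNReal.ofReal (v μ (y + x)) ∂μ = ENNReal.ofReal (w μ y) := by
  have hs : MeasurableSet {p : ℝ × ℝ | -y < p.1 + p.2} :=
    measurableSet_lt measurable_const (measurable_fst.add measurable_snd)
  rw [w, Measure.real, ENNReal.ofReal_toReal (measure_ne_top _ _), Measure.prod_apply hs]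
  refine lintegral_congr fun x => ?_
  rw [v, Measure.real, ENNReal.ofReal_toReal (measure_ne_top _ _)]
  congr 1
  ext z
  change -(y + x) < z ↔ -y < x + z
  constructor <;> intro h <;> linarith

/-- One step of the importance sampler started from `y`:
`Q_a(y, dz) = P(y + X ∈ dz) v(z + a) / w(y + a)`.  If the normalising constant `w (y + a)` vanishes
(which does not happen when `X` has an everywhere positive tail), the chain stays put. -/
noncomputable def stepLaw (μ : Measure ℝ) [IsFiniteMeasure μ] (a y : ℝ) : Measure ℝ :=
  if w μ (y + a) = 0 then Measure.dirac y
  else (μ.map (fun x => y + x)).withDensity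
    (fun z => ENNReal.ofReal (v μ (z + a) / w μ (y + a)))

lemma measurable_density (μ : Measure ℝ) [IsFiniteMeasure μ] (a : ℝ) :
    Measurable (fun p : ℝ × ℝ => ENNReal.ofReal (v μ (p.1 + p.2 + a) / w μ (p.1 + a))) :=
  (((monotone_v μ).measurable.comp ((measurable_fst.add measurable_snd).add_const a)).div
    ((monotone_w μ).measurable.comp (measurable_fst.add_const a))).ennreal_ofReal

lemma stepLaw_apply (μ : Measure ℝ) [IsFiniteMeasure μ] (a y : ℝ) (hw : w μ (y + a) ≠ 0)
    {s : Set ℝ} (hs : MeasurableSet s) :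
    stepLaw μ a y s = ∫⁻ x, s.indicator (fun _ => (1 : ENNReal)) (y + x) *
      ENNReal.ofReal (v μ (y + x + a) / w μ (y + a)) ∂μ := by
  have hm : Measurable (fun z => ENNReal.ofReal (v μ (z + a) / w μ (y + a))) :=
    (((monotone_v μ).measurable.comp (measurable_id.add_const a)).div_const _).ennreal_ofReal
  rw [stepLaw, if_neg hw, withDensity_apply _ hs, ← lintegral_indicator hs,
    lintegral_map (hm.indicator hs) (measurable_const_add y)]
  refine lintegral_congr fun x => ?_
  by_cases hx : y + x ∈ s <;> simp [hx]

/-- The transition kernel `Q_a` of the importance sampler. -/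
noncomputable def stepKernel (μ : Measure ℝ) [IsFiniteMeasure μ] (a : ℝ) : Kernel ℝ ℝ where
  toFun := stepLaw μ a
  measurable' := by
    refine Measure.measurable_of_measurable_coe _ fun s hs => ?_
    have hset : MeasurableSet {y : ℝ | w μ (y + a) = 0} :=
      ((monotone_w μ).measurable.comp (measurable_id.add_const a)) (measurableSet_singleton 0)
    have h1 : Measurable (fun y : ℝ => ∫⁻ x, s.indicator (fun _ => (1 : ENNReal)) (y + x) *
        ENNReal.ofReal (v μ (y + x + a) / w μ (y + a)) ∂μ) :=
      Measurable.lintegral_prod_right'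
        (((measurable_const.indicator hs).comp (measurable_fst.add measurable_snd)).mul
          (measurable_density μ a))
    have h2 : Measurable (fun y : ℝ => Measure.dirac y s) :=
      (Measure.measurable_coe hs).comp Measure.measurable_dirac
    have h3 : Measurable (fun y : ℝ => if w μ (y + a) = 0 then Measure.dirac y s else
        ∫⁻ x, s.indicator (fun _ => (1 : ENNReal)) (y + x) *
          ENNReal.ofReal (v μ (y + x + a) / w μ (y + a)) ∂μ) := Measurable.ite hset h2 h1
    convert h3 using 1
    funext y
    by_cases hy : w μ (y + a) = 0
    · simp [stepLaw, hy]
    · rw [stepLaw_apply μ a y hy hs]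
      simp [hy]

instance instIsMarkovKernel_stepKernel (μ : Measure ℝ) [IsFiniteMeasure μ] (a : ℝ) :
    IsMarkovKernel (stepKernel μ a) := by
  refine ⟨fun y => ⟨?_⟩⟩
  change stepLaw μ a y Set.univ = 1
  by_cases hy : w μ (y + a) = 0
  · simp [stepLaw, hy]
  · have hpos : 0 < w μ (y + a) := lt_of_le_of_ne (w_nonneg μ _) (Ne.symm hy)
    have h : ∀ x : ℝ, ENNReal.ofReal (v μ (y + x + a) / w μ (y + a)) =
        ENNReal.ofReal (v μ (y + a + x)) * (ENNReal.ofReal (w μ (y + a)))⁻¹ := by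
      intro x
      rw [ENNReal.ofReal_div_of_pos hpos, div_eq_mul_inv, add_right_comm]
    rw [stepLaw_apply μ a y hy MeasurableSet.univ]
    simp only [Set.indicator_univ, one_mul, h]
    rw [lintegral_mul_const' _ _ (by simpa using hpos), lintegral_v]
    exact ENNReal.mul_inv_cancel (by simpa using hpos) ENNReal.ofReal_ne_top

/-- The kernel giving the position at time `n + 1` from the positions up to time `n`, when the
position is a Markov chain with transition kernel `Q_a`. -/
noncomputable def historyKernel (μ : Measure ℝ) [IsFiniteMeasure μ] (a : ℝ) (n : ℕ) :
    Kernel (Π _ : Finset.Iic n, ℝ) ℝ :=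
  (stepKernel μ a).comap (fun s => s ⟨n, Finset.mem_Iic.2 le_rfl⟩) (measurable_pi_apply _)

instance instIsMarkovKernel_historyKernel (μ : Measure ℝ) [IsFiniteMeasure μ] (a : ℝ) (n : ℕ) :
    IsMarkovKernel (historyKernel μ a n) := by
  unfold historyKernel
  infer_instance

/-- The law, on path space, of the Markov chain `(S_n)` with `S_0 = y` and transition
kernel `Q_a`. -/
noncomputable def pathLaw (μ : Measure ℝ) [IsFiniteMeasure μ] (a y : ℝ) : Measure (ℕ → ℝ) :=
  Kernel.traj (X := fun _ => ℝ) (historyKernel μ a) 0 (fun _ => y)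

/-- The event `τ(0) < ∞`. -/
def crosses : Set (ℕ → ℝ) := {s | ∃ n, 0 < s n}

/-- `τ(0) = inf {n ≥ 0 : S_n > 0}`, used on the event `τ(0) < ∞` only. -/
noncomputable def crossingTime (s : ℕ → ℝ) : ℕ := sInf {n | 0 < s n}

/-- The estimator `R = I(τ(0) < ∞) ∏_{k = 1}^{τ(0)} w(S_{k-1} + a) / v(S_k + a)`. -/
noncomputable def estimator (μ : Measure ℝ) [IsFiniteMeasure μ] (a : ℝ) : (ℕ → ℝ) → ℝ :=
  crosses.indicator
    (fun s => ∏ k ∈ Finset.Icc 1 (crossingTime s), w μ (s (k - 1) + a) / v μ (s k + a))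

/-- The all-time supremum `M` of the random walk with increments `X 0, X 1, …`, started at `0`. -/
noncomputable def walkMax {Ω : Type*} (X : ℕ → Ω → ℝ) (ω : Ω) : EReal :=
  ⨆ n : ℕ, ((∑ i ∈ Finset.range n, X i ω : ℝ) : EReal)

/-- Strong efficiency of a family of estimators `R b` of the probabilities `p b`, where `R b` is
simulated under the probability law `Q b`: `R b` is a random variable, it is unbiased, and
`sup_{b > 0} E R(b)² / p(b)² < ∞`. -/
structure StronglyEfficient {E : Type*} [MeasurableSpace E] (Q : ℝ → Measure E) (R : ℝ → E → ℝ)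
    (p : ℝ → ENNReal) : Prop where
  measurable : ∀ b, 0 < b → Measurable (R b)
  unbiased : ∀ b, 0 < b → Integrable (R b) (Q b) ∧ ENNReal.ofReal (∫ s, R b s ∂(Q b)) = p b
  bounded : ⨆ b : Set.Ioi (0 : ℝ),
    (∫⁻ s, ENNReal.ofReal (R b s ^ 2) ∂(Q b)) / p b ^ 2 < ⊤

end TailIS

namespace TailIS

open scoped ENNReal

/-! Split every expectation according to the first time `n` at which the path enters `(0, ∞)`. On
that event the integrand is a product of one-step weights, so its contribution is an iterate of a
single operator `stepOp` on functions of the position (`weightedBelow_succ`). Path-space claims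
thereby become one-step claims.

Unbiasedness: multiplying the sampler's kernel by `w/v` gives back the kernel of the random walk, so
weighted sampler and unweighted walk have the same operator (`stepOp_ratio`). Their first-crossing
terms agree one by one, and the walk started at `-b` crosses `0` exactly when `M > b`.

Second moment: here the weights are squared, and a Lyapunov function suffices
(`tsum_weightedBelow_le`). Take `h = A v(· + a)²` on `(-∞, 0]` and `h = 1` on `(0, ∞)`, with `A = (1
- γ)⁻¹ κ⁻²`. From `x ≤ 0` with `y = x + a`, one factor of the squared ratio is absorbed by the
change of measure. The remaining integrand is at most `A w(y) (v(y + X) - γ 1{X > -y})`, whose mean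
is `A w(y) (w(y) - γ P(X > -y))`. The hypothesis on `a` says precisely that this is at most `A
v(y)²`.

Bounded relative error: since `a ≤ 0`, it remains to prove `v(-b) ≤ C P(M > b)`. This is a
one-big-jump lower bound. Take `c > 0` with `c ≥ 4 E|X|`; Markov's inequality gives `P(S_n < -cn) ≤
1/4`. If also `P(M > b) ≤ 1/4`, then with probability at least `1/2` the walk has not crossed by
time `n` and is at distance at most `b + cn` from `0`, so a next jump above `b + cn` crosses.
Summing these disjoint events gives `P(M > b) ≥ (1/2) ∑ P(X > b + cn) ≥ (2c)⁻¹ ∫_b^∞ P(X > s) ds`.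
If instead `P(M > b) > 1/4`, the bound `v ≤ 1` is enough.

The class `S*` enters through positivity of the tail of `X`, which makes `v` and `w` positive. -/

/-- `ν` is the law of a sequence whose position at time `n + 1` has, given the past up to time `n`,
the law `κ (s n)`. -/
def IsMarkovChain (ν : Measure (ℕ → ℝ)) (κ : Kernel ℝ ℝ) : Prop :=
  ∀ (n : ℕ) (G : (ℕ → ℝ) → ℝ≥0∞) (H : ℝ → ℝ → ℝ≥0∞), Measurable G →
    (∀ s : ℕ → ℝ, G (fun k => s (min k n)) = G s) → Measurable (Function.uncurry H) →
    ∫⁻ s, G s * H (s n) (s (n + 1)) ∂ν = ∫⁻ s, G s * ∫⁻ z, H (s n) z ∂(κ (s n)) ∂ν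

/-- The path law of the importance sampler is the law of a Markov chain. -/
lemma isMarkovChain_pathLaw (μ : Measure ℝ) [IsFiniteMeasure μ] (a y : ℝ) :
    IsMarkovChain (pathLaw μ a y) (stepKernel μ a) := by
  intro n G H hG hGn hH
  -- A finite history is extended to a path frozen at its last value; `hGn` says that `G` does not
  -- see the freezing.
  let e : (Π _ : Finset.Iic n, ℝ) → ℕ → ℝ :=
    fun u k => u ⟨min k n, Finset.mem_Iic.2 (min_le_right k n)⟩
  have he : Measurable e := measurable_pi_lambda _ fun k => measurable_pi_apply _
  let F : (Π _ : Finset.Iic n, ℝ) × ℝ → ℝ≥0∞ := fun p => G (e p.1) * H (e p.1 n) p.2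
  have hF : Measurable F := (hG.comp (he.comp measurable_fst)).mul
    (hH.comp (((measurable_pi_apply n).comp (he.comp measurable_fst)).prodMk measurable_snd))
  have key := Kernel.partialTraj_compProd_eq_map_traj (X := fun _ => ℝ)
    (κ := historyKernel μ a) (Nat.zero_le n) (x₀ := fun _ => y)
  have heG : ∀ s : ℕ → ℝ, G (e (Preorder.frestrictLe n s)) = G s := fun s => hGn s
  have hen : ∀ s : ℕ → ℝ, e (Preorder.frestrictLe n s) n = s n := by
    intro s
    change s (min n n) = s n
    rw [min_self]
  have hm : Measurable (fun x : ℕ → ℝ =>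
      ((Preorder.frestrictLe n x : Π _ : Finset.Iic n, ℝ), x (n + 1))) :=
    (Preorder.measurable_frestrictLe n).prodMk (measurable_pi_apply _)
  have hin : Measurable (fun u => ∫⁻ z, F (u, z) ∂(historyKernel μ a n u)) :=
    Measurable.lintegral_kernel_prod_right' hF
  have h1 : ∫⁻ s, G s * H (s n) (s (n + 1)) ∂(pathLaw μ a y) =
      ∫⁻ p, F p ∂((pathLaw μ a y).map (fun x : ℕ → ℝ =>
      ((Preorder.frestrictLe n x : Π _ : Finset.Iic n, ℝ), x (n + 1)))) := by
    rw [lintegral_map hF hm]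
    refine lintegral_congr fun s => ?_
    simp only [F, heG, hen]
  rw [h1]
  unfold pathLaw
  rw [← key, Measure.lintegral_compProd hF,
    ← Kernel.traj_map_frestrictLe_apply, lintegral_map hin (Preorder.measurable_frestrictLe n)]
  refine lintegral_congr fun s => ?_
  have hk : historyKernel μ a n (Preorder.frestrictLe n s) = stepKernel μ a (s n) := rfl
  have hHs : Measurable (H (s n)) := hH.comp (measurable_const.prodMk measurable_id)
  rw [hk]
  simp only [F, heG, hen]
  rw [lintegral_const_mul _ hHs]

lemma lintegral_pathLaw_zero (μ : Measure ℝ) [IsFiniteMeasure μ] (a y : ℝ) {φ : ℝ → ℝ≥0∞}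
    (hφ : Measurable φ) : ∫⁻ s, φ (s 0) ∂(pathLaw μ a y) = φ y := by
  have key := Kernel.traj_map_frestrictLe_apply (X := fun _ => ℝ)
    (κ := historyKernel μ a) 0 0 (fun _ => y)
  let i : Finset.Iic 0 := ⟨0, Finset.mem_Iic.2 le_rfl⟩
  have hφi : Measurable fun u : Π _ : Finset.Iic 0, ℝ => φ (u i) :=
    hφ.comp (measurable_pi_apply i)
  have h1 : ∫⁻ s, φ (s 0) ∂(pathLaw μ a y) =
      ∫⁻ u : Π _ : Finset.Iic 0, ℝ, φ (u i)
        ∂((pathLaw μ a y).map (Preorder.frestrictLe (π := fun _ => ℝ) 0)) := by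
    rw [lintegral_map hφi (Preorder.measurable_frestrictLe 0)]
    rfl
  rw [h1]
  unfold pathLaw
  rw [key, Kernel.partialTraj_self, Kernel.id_apply,
    lintegral_dirac' _ hφi]

/-! ### First-crossing decomposition and the one-step operator -/

/-- The paths staying in `(-∞, 0]` at all times before `n`. -/
def below (n : ℕ) : Set (ℕ → ℝ) := {s | ∀ k < n, s k ≤ 0}

/-- The paths entering `(0, ∞)` for the first time at time `n`. -/
def firstCross (n : ℕ) : Set (ℕ → ℝ) := below n ∩ {s | 0 < s n}

lemma measurableSet_below (n : ℕ) : MeasurableSet (below n) := by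
  have : below n = ⋂ k : ℕ, ⋂ _ : k < n, {s : ℕ → ℝ | s k ≤ 0} := by
    ext s
    simp [below]
  rw [this]
  exact MeasurableSet.iInter fun k => MeasurableSet.iInter fun _ =>
    measurableSet_le (measurable_pi_apply k) measurable_const

lemma measurableSet_firstCross (n : ℕ) : MeasurableSet (firstCross n) :=
  (measurableSet_below n).inter (measurableSet_lt measurable_const (measurable_pi_apply n))

lemma disjoint_firstCross : Pairwise (Function.onFun Disjoint firstCross) := by
  have h : ∀ m n : ℕ, m < n → Disjoint (firstCross m) (firstCross n) := fun m n hmn =>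
    Set.disjoint_left.2 fun s hm hn => not_le.2 hm.2 (hn.1 m hmn)
  intro m n hmn
  rcases lt_or_gt_of_ne hmn with h' | h'
  · exact h m n h'
  · exact (h n m h').symm

lemma crosses_eq_iUnion : crosses = ⋃ n, firstCross n := by
  classical
  ext s
  simp only [crosses, Set.mem_iUnion]
  constructor
  · intro h
    exact ⟨Nat.find h, fun k hk => not_lt.1 (Nat.find_min h hk), Nat.find_spec h⟩
  · rintro ⟨n, hn⟩
    exact ⟨n, hn.2⟩

lemma measurableSet_crosses : MeasurableSet crosses := by
  rw [crosses_eq_iUnion]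
  exact MeasurableSet.iUnion measurableSet_firstCross

lemma crossingTime_of_mem {n : ℕ} {s : ℕ → ℝ} (hs : s ∈ firstCross n) : crossingTime s = n := by
  refine le_antisymm (Nat.sInf_le hs.2) (le_csInf ⟨n, hs.2⟩ fun k hk => ?_)
  by_contra h
  exact not_le.2 hk (hs.1 k (not_le.1 h))

/-- The `L`-weighted expectation of `φ (s n)` over the paths that stay in `(-∞, 0]`
before time `n`. -/
noncomputable def weightedBelow (ν : Measure (ℕ → ℝ)) (L : ℝ → ℝ → ℝ≥0∞) (n : ℕ)
    (φ : ℝ → ℝ≥0∞) : ℝ≥0∞ :=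
  ∫⁻ s, (below n).indicator (fun s => ∏ k ∈ Finset.range n, L (s k) (s (k + 1))) s * φ (s n) ∂ν

/-- The one-step operator that drives `weightedBelow`. -/
noncomputable def stepOp (κ : Kernel ℝ ℝ) (L : ℝ → ℝ → ℝ≥0∞) (φ : ℝ → ℝ≥0∞) : ℝ → ℝ≥0∞ :=
  (Set.Iic 0).indicator fun x => ∫⁻ z, L x z * φ z ∂(κ x)

section Chain

variable {ν : Measure (ℕ → ℝ)} {κ : Kernel ℝ ℝ} {L : ℝ → ℝ → ℝ≥0∞}

lemma measurable_prod_weights (hL : Measurable (Function.uncurry L)) (n : ℕ) :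
    Measurable (fun s : ℕ → ℝ => ∏ k ∈ Finset.range n, L (s k) (s (k + 1))) :=
  Finset.measurable_prod _ fun k _ =>
    hL.comp (f := fun s : ℕ → ℝ => (s k, s (k + 1)))
      ((measurable_pi_apply k).prodMk (measurable_pi_apply (k + 1)))

lemma measurable_stepOp [IsSFiniteKernel κ] (hL : Measurable (Function.uncurry L))
    {φ : ℝ → ℝ≥0∞} (hφ : Measurable φ) : Measurable (stepOp κ L φ) := by
  refine Measurable.indicator ?_ measurableSet_Iic
  exact Measurable.lintegral_kernel_prod_right' (f := fun p : ℝ × ℝ => L p.1 p.2 * φ p.2)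
    (hL.mul (hφ.comp measurable_snd))

/-- The last factor of the product is integrated out by the Markov property at time `n`; the
constraint `s n ≤ 0` becomes the indicator in `stepOp`. -/
lemma weightedBelow_succ (hν : IsMarkovChain ν κ) (hL : Measurable (Function.uncurry L)) (n : ℕ)
    {φ : ℝ → ℝ≥0∞} (hφ : Measurable φ) :
    weightedBelow ν L (n + 1) φ = weightedBelow ν L n (stepOp κ L φ) := by
  -- The mismatch is deliberate: `below (n + 1)` constrains times up to `n`, and the first `n`
  -- factors also involve only times up to `n`, so `G` belongs to the past.
  let G : (ℕ → ℝ) → ℝ≥0∞ := fun s =>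
    (below (n + 1)).indicator (fun s => ∏ k ∈ Finset.range n, L (s k) (s (k + 1))) s
  have hG : Measurable G := (measurable_prod_weights hL n).indicator (measurableSet_below _)
  have hGn : ∀ s : ℕ → ℝ, G (fun k => s (min k n)) = G s := by
    intro s
    have hmem : (fun k => s (min k n)) ∈ below (n + 1) ↔ s ∈ below (n + 1) := by
      refine forall_congr' fun k => forall_congr' fun hk => ?_
      change s (min k n) ≤ 0 ↔ s k ≤ 0
      rw [min_eq_left (Nat.lt_succ_iff.1 hk)]
    by_cases hs : s ∈ below (n + 1)
    · simp only [G]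
      rw [Set.indicator_of_mem hs, Set.indicator_of_mem (hmem.2 hs)]
      refine Finset.prod_congr rfl fun k hk => ?_
      have hk' := Finset.mem_range.1 hk
      change L (s (min k n)) (s (min (k + 1) n)) = _
      rw [min_eq_left hk'.le, min_eq_left (Nat.succ_le_of_lt hk')]
    · simp only [G]
      rw [Set.indicator_of_notMem hs, Set.indicator_of_notMem (mt hmem.1 hs)]
  have key := hν n G (fun x z => L x z * φ z) hG hGn (hL.mul (hφ.comp measurable_snd))
  have hsub : ∀ s : ℕ → ℝ, s ∈ below (n + 1) ↔ s ∈ below n ∧ s n ≤ 0 := by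
    intro s
    constructor
    · exact fun h => ⟨fun k hk => h k (hk.trans n.lt_succ_self), h n n.lt_succ_self⟩
    · rintro ⟨h, hn⟩ k hk
      rcases Nat.lt_succ_iff_lt_or_eq.1 hk with h' | rfl
      exacts [h k h', hn]
  unfold weightedBelow
  refine Eq.trans ?_ (key.trans ?_)
  · refine lintegral_congr fun s => ?_
    by_cases hs : s ∈ below (n + 1)
    · simp only [G]
      rw [Set.indicator_of_mem hs, Set.indicator_of_mem hs, Finset.prod_range_succ, mul_assoc]
    · simp only [G]
      rw [Set.indicator_of_notMem hs, Set.indicator_of_notMem hs, zero_mul, zero_mul]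
  · refine lintegral_congr fun s => ?_
    simp only [G, stepOp]
    by_cases h1 : s ∈ below n
    · by_cases h2 : s n ≤ 0
      · rw [Set.indicator_of_mem ((hsub s).2 ⟨h1, h2⟩), Set.indicator_of_mem h1,
          Set.indicator_of_mem (Set.mem_Iic.2 h2)]
      · rw [Set.indicator_of_notMem (fun h => h2 ((hsub s).1 h).2),
          Set.indicator_of_notMem (s := Set.Iic (0 : ℝ)) h2, zero_mul, mul_zero]
    · rw [Set.indicator_of_notMem (fun h => h1 ((hsub s).1 h).1),
        Set.indicator_of_notMem h1, zero_mul, zero_mul]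

lemma weightedBelow_mono {n : ℕ} {φ ψ : ℝ → ℝ≥0∞} (h : φ ≤ ψ) :
    weightedBelow ν L n φ ≤ weightedBelow ν L n ψ :=
  lintegral_mono fun s => mul_le_mul_right (h (s n)) _

lemma weightedBelow_add (hL : Measurable (Function.uncurry L)) {n : ℕ} {φ ψ : ℝ → ℝ≥0∞}
    (hφ : Measurable φ) :
    weightedBelow ν L n (φ + ψ) = weightedBelow ν L n φ + weightedBelow ν L n ψ := by
  unfold weightedBelow
  rw [← lintegral_add_left]
  · exact lintegral_congr fun s => mul_add _ _ _
  · exact ((measurable_prod_weights hL n).indicator (measurableSet_below n)).mul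
      (hφ.comp (measurable_pi_apply n))

/-- The contribution of the paths that first cross at time `n`. -/
lemma weightedBelow_indicator_Ioi (n : ℕ) :
    weightedBelow ν L n ((Set.Ioi 0).indicator 1) =
      ∫⁻ s, (firstCross n).indicator
        (fun s => ∏ k ∈ Finset.range n, L (s k) (s (k + 1))) s ∂ν := by
  refine lintegral_congr fun s => ?_
  by_cases h1 : s ∈ below n
  · by_cases h2 : 0 < s n
    · rw [Set.indicator_of_mem h1, Set.indicator_of_mem (Set.mem_Ioi.2 h2),
        Set.indicator_of_mem (show s ∈ firstCross n from ⟨h1, h2⟩)]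
      simp
    · rw [Set.indicator_of_notMem (s := Set.Ioi (0 : ℝ)) h2, mul_zero,
        Set.indicator_of_notMem fun h => h2 h.2]
  · rw [Set.indicator_of_notMem h1, zero_mul, Set.indicator_of_notMem fun h => h1 h.1]

/-- Two chains with the same start and the same one-step operator give the same values. -/
lemma weightedBelow_congr {ν' : Measure (ℕ → ℝ)} {κ' : Kernel ℝ ℝ} {L' : ℝ → ℝ → ℝ≥0∞}
    [IsSFiniteKernel κ] (hν : IsMarkovChain ν κ) (hν' : IsMarkovChain ν' κ')
    (hL : Measurable (Function.uncurry L)) (hL' : Measurable (Function.uncurry L'))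
    (h0 : ∀ φ : ℝ → ℝ≥0∞, Measurable φ → ∫⁻ s, φ (s 0) ∂ν = ∫⁻ s, φ (s 0) ∂ν')
    (hstep : ∀ φ : ℝ → ℝ≥0∞, Measurable φ → stepOp κ L φ = stepOp κ' L' φ) (n : ℕ) :
    ∀ φ : ℝ → ℝ≥0∞, Measurable φ → weightedBelow ν L n φ = weightedBelow ν' L' n φ := by
  induction n with
  | zero =>
    intro φ hφ
    have hb : below 0 = Set.univ := Set.eq_univ_of_forall fun s k hk => absurd hk k.not_lt_zero
    simpa [weightedBelow, hb] using h0 φ hφ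
  | succ n ih =>
    intro φ hφ
    rw [weightedBelow_succ hν hL n hφ, weightedBelow_succ hν' hL' n hφ, ← hstep φ hφ]
    exact ih _ (measurable_stepOp hL hφ)

/-- A Lyapunov function bounds the weighted number of crossings. -/
lemma tsum_weightedBelow_le (hν : IsMarkovChain ν κ) (hL : Measurable (Function.uncurry L))
    {h : ℝ → ℝ≥0∞} (hm : Measurable h) (hpos : ∀ z, 0 < z → 1 ≤ h z)
    (hstep : ∀ x ≤ 0, ∫⁻ z, L x z * h z ∂(κ x) ≤ h x) :
    ∑' n, weightedBelow ν L n ((Set.Ioi 0).indicator 1) ≤ ∫⁻ s, h (s 0) ∂ν := by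
  have hb : below 0 = Set.univ := Set.eq_univ_of_forall fun s k hk => absurd hk k.not_lt_zero
  have h0 : weightedBelow ν L 0 h = ∫⁻ s, h (s 0) ∂ν := by simp [weightedBelow, hb]
  have hone : Measurable ((Set.Ioi (0 : ℝ)).indicator (1 : ℝ → ℝ≥0∞)) :=
    measurable_one.indicator measurableSet_Ioi
  -- The two summands live on complementary half-lines, so each hypothesis on `h` settles one of
  -- them.
  have hle : (Set.Ioi (0 : ℝ)).indicator (1 : ℝ → ℝ≥0∞) + stepOp κ L h ≤ h := by
    intro x
    by_cases hx : x ≤ 0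
    · simpa [stepOp, hx] using hstep x hx
    · simpa [stepOp, hx, not_le.1 hx] using hpos x (not_le.1 hx)
  -- At each step the crossing term is paid out of `h` and the rest is carried on, so the total
  -- never increases.
  have hfin : ∀ n : ℕ, ∑ k ∈ Finset.range n, weightedBelow ν L k ((Set.Ioi 0).indicator 1) +
      weightedBelow ν L n h ≤ weightedBelow ν L 0 h := by
    intro n
    induction n with
    | zero => simp
    | succ n ih =>
      refine le_trans ?_ ih
      rw [Finset.sum_range_succ, add_assoc, weightedBelow_succ hν hL n hm,
        ← weightedBelow_add hL hone]
      exact add_le_add_right (weightedBelow_mono hle) _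
  rw [← h0, ENNReal.tsum_eq_iSup_nat]
  exact iSup_le fun n => le_self_add.trans (hfin n)

end Chain

/-! ### The estimator as a series over crossing times -/

/-- The first-crossing events partition `crosses`, so at most one term of the series is nonzero. The
exponent must be nonzero because `0 ^ 0 = 1` off `crosses`. -/
lemma ofReal_indicator_crosses_pow (f : ℕ → (ℕ → ℝ) → ℝ) (hf : ∀ n s, 0 ≤ f n s) (p : ℕ)
    (hp : p ≠ 0) (s : ℕ → ℝ) :
    ENNReal.ofReal (crosses.indicator (fun s => f (crossingTime s) s) s ^ p) =
      ∑' n, (firstCross n).indicator (fun s => ENNReal.ofReal (f n s) ^ p) s := by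
  by_cases hs : s ∈ crosses
  · rw [Set.indicator_of_mem hs]
    rw [crosses_eq_iUnion] at hs
    obtain ⟨n, hn⟩ := Set.mem_iUnion.1 hs
    rw [crossingTime_of_mem hn, tsum_eq_single n, Set.indicator_of_mem hn,
      ENNReal.ofReal_pow (hf n s)]
    intro m hmn
    exact Set.indicator_of_notMem (fun hm => Set.disjoint_left.1 (disjoint_firstCross hmn) hm hn) _
  · rw [Set.indicator_of_notMem hs, zero_pow hp, ENNReal.ofReal_zero]
    rw [crosses_eq_iUnion, Set.mem_iUnion, not_exists] at hs
    simp [Set.indicator_of_notMem (hs _)]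

/-- The likelihood ratio of one step of the importance sampler. -/
noncomputable def ratio (μ : Measure ℝ) [IsFiniteMeasure μ] (a x z : ℝ) : ℝ :=
  w μ (x + a) / v μ (z + a)

lemma ratio_nonneg (μ : Measure ℝ) [IsFiniteMeasure μ] (a x z : ℝ) : 0 ≤ ratio μ a x z :=
  div_nonneg (w_nonneg μ _) (v_nonneg μ _)

lemma measurable_ratio (μ : Measure ℝ) [IsFiniteMeasure μ] (a : ℝ) :
    Measurable (Function.uncurry (ratio μ a)) :=
  ((monotone_w μ).measurable.comp (measurable_fst.add_const a)).div
    ((monotone_v μ).measurable.comp (measurable_snd.add_const a))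

lemma estimator_eq (μ : Measure ℝ) [IsFiniteMeasure μ] (a : ℝ) :
    estimator μ a = crosses.indicator fun s =>
      ∏ k ∈ Finset.range (crossingTime s), ratio μ a (s k) (s (k + 1)) := by
  unfold estimator
  congr 1
  funext s
  rw [← Finset.Ico_add_one_right_eq_Icc, Finset.prod_Ico_eq_prod_range]
  simp [ratio, add_comm]

lemma lintegral_estimator_pow (μ : Measure ℝ) [IsFiniteMeasure μ] (a : ℝ) (ν : Measure (ℕ → ℝ))
    {p : ℕ} (hp : p ≠ 0) :
    ∫⁻ s, ENNReal.ofReal (estimator μ a s ^ p) ∂ν =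
      ∑' n, weightedBelow ν (fun x z => ENNReal.ofReal (ratio μ a x z) ^ p) n
        ((Set.Ioi 0).indicator 1) := by
  have hm : Measurable (Function.uncurry fun x z => ENNReal.ofReal (ratio μ a x z) ^ p) :=
    (measurable_ratio μ a).ennreal_ofReal.pow_const p
  simp only [weightedBelow_indicator_Ioi]
  rw [← lintegral_tsum fun n =>
    ((measurable_prod_weights hm n).indicator (measurableSet_firstCross n)).aemeasurable]
  refine lintegral_congr fun s => ?_
  rw [estimator_eq, ofReal_indicator_crosses_pow
    (fun n s => ∏ k ∈ Finset.range n, ratio μ a (s k) (s (k + 1)))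
    (fun n s => Finset.prod_nonneg fun k _ => ratio_nonneg μ a _ _) p hp s]
  refine tsum_congr fun n => ?_
  congr 1
  funext s
  rw [ENNReal.ofReal_prod_of_nonneg fun k _ => ratio_nonneg μ a _ _, Finset.prod_pow]

lemma estimator_nonneg (μ : Measure ℝ) [IsFiniteMeasure μ] (a : ℝ) (s : ℕ → ℝ) :
    0 ≤ estimator μ a s := by
  rw [estimator_eq]
  exact Set.indicator_nonneg (fun s _ => Finset.prod_nonneg fun k _ => ratio_nonneg μ a _ _) s

/-- The product has a random number of factors; the first-crossing series (with `p = 1`) replaces it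
by countably many products of fixed length. -/
lemma measurable_estimator (μ : Measure ℝ) [IsFiniteMeasure μ] (a : ℝ) :
    Measurable (estimator μ a) := by
  have hm : Measurable (Function.uncurry fun x z => ENNReal.ofReal (ratio μ a x z) ^ 1) :=
    (measurable_ratio μ a).ennreal_ofReal.pow_const 1
  have h : estimator μ a = fun s => (∑' n, (firstCross n).indicator (fun s =>
      ∏ k ∈ Finset.range n, ENNReal.ofReal (ratio μ a (s k) (s (k + 1))) ^ 1) s).toReal := by
    funext s
    have := ofReal_indicator_crosses_pow
      (fun n s => ∏ k ∈ Finset.range n, ratio μ a (s k) (s (k + 1)))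
      (fun n s => Finset.prod_nonneg fun k _ => ratio_nonneg μ a _ _) 1 one_ne_zero s
    rw [← estimator_eq, pow_one] at this
    rw [← ENNReal.toReal_ofReal (estimator_nonneg μ a s), this]
    congr 1
    refine tsum_congr fun n => ?_
    congr 1
    funext s
    rw [ENNReal.ofReal_prod_of_nonneg fun k _ => ratio_nonneg μ a _ _, Finset.prod_pow]
  rw [h]
  exact (Measurable.tsum fun n =>
    (measurable_prod_weights hm n).indicator (measurableSet_firstCross n)).ennreal_toReal

/-! ### The random walk as a Markov chain -/

/-- The transition kernel of the random walk whose increments have law `μ`. -/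
noncomputable def walkKernel (μ : Measure ℝ) [IsFiniteMeasure μ] : Kernel ℝ ℝ :=
  (Kernel.id ×ₖ Kernel.const ℝ μ).map (fun p : ℝ × ℝ => p.1 + p.2)

instance instIsFiniteKernel_walkKernel (μ : Measure ℝ) [IsFiniteMeasure μ] :
    IsFiniteKernel (walkKernel μ) := by
  unfold walkKernel
  infer_instance

lemma lintegral_walkKernel (μ : Measure ℝ) [IsFiniteMeasure μ] (x : ℝ) {f : ℝ → ℝ≥0∞}
    (hf : Measurable f) : ∫⁻ z, f z ∂(walkKernel μ x) = ∫⁻ u, f (x + u) ∂μ := by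
  have hadd : Measurable (fun p : ℝ × ℝ => p.1 + p.2) := measurable_fst.add measurable_snd
  rw [walkKernel, Kernel.map_apply _ hadd, lintegral_map hf hadd,
    Kernel.lintegral_id_prod (f := fun p : ℝ × ℝ => f (p.1 + p.2)) (hf.comp hadd),
    Kernel.const_apply]

section Walk

variable {Ω : Type*}

/-- The random walk started from `y` with increments `X 0, X 1, …`. -/
def walkPath (X : ℕ → Ω → ℝ) (y : ℝ) (ω : Ω) (n : ℕ) : ℝ := y + ∑ i ∈ Finset.range n, X i ω

lemma lt_walkMax_iff (X : ℕ → Ω → ℝ) (b : ℝ) (ω : Ω) :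
    (b : EReal) < walkMax X ω ↔ walkPath X (-b) ω ∈ crosses := by
  simp only [walkMax, lt_iSup_iff, EReal.coe_lt_coe_iff]
  refine exists_congr fun n => ?_
  unfold walkPath
  constructor <;> intro h <;> linarith

variable [MeasurableSpace Ω] {P : Measure Ω} {X : ℕ → Ω → ℝ}

lemma aemeasurable_walkPath (hX : ∀ n, AEMeasurable (X n) P) (y : ℝ) :
    AEMeasurable (walkPath X y) P := by
  refine aemeasurable_pi_lambda _ fun n => ?_
  exact (Finset.aemeasurable_fun_sum _ fun i _ => hX i).const_add y

/-- The random walk is a Markov chain. -/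
lemma isMarkovChain_walk [IsProbabilityMeasure P] {μ : Measure ℝ} [IsProbabilityMeasure μ]
    (hlaw : ∀ n, HasLaw (X n) μ P) (hindep : iIndepFun X P) (y : ℝ) :
    IsMarkovChain (P.map (walkPath X y)) (walkKernel μ) := by
  intro n G H hG hGn hH
  have hX : ∀ n, AEMeasurable (X n) P := fun n => (hlaw n).aemeasurable
  have hW := aemeasurable_walkPath hX y
  let U : Ω → (Finset.range n → ℝ) := fun ω i => X i ω
  have hU : AEMeasurable U P := aemeasurable_pi_lambda _ fun i => hX i
  -- Rebuilds the walk frozen at time `n` from its first `n` increments, which are independent of `X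
  -- n`.
  let e : (Finset.range n → ℝ) → ℕ → ℝ :=
    fun u k => y + ∑ i : Finset.range n, if (i : ℕ) < k then u i else 0
  have he : Measurable e := by
    refine measurable_pi_lambda _ fun k => Measurable.const_add ?_ y
    refine Finset.measurable_fun_sum _ fun i _ => ?_
    split_ifs
    exacts [measurable_pi_apply i, measurable_const]
  have heU : ∀ ω, e (U ω) = fun k => walkPath X y ω (min k n) := by
    intro ω
    funext k
    simp only [e, U, walkPath]
    congr 1
    rw [Finset.sum_coe_sort (Finset.range n) (fun i => if i < k then X i ω else 0),
      ← Finset.sum_filter]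
    congr 1
    ext i
    simp only [Finset.mem_filter, Finset.mem_range, lt_min_iff]
    tauto
  have heG : ∀ ω, G (e (U ω)) = G (walkPath X y ω) := fun ω => by rw [heU, hGn]
  have hen : ∀ ω, e (U ω) n = walkPath X y ω n := fun ω => by
    rw [heU]
    exact congrArg _ (min_self n)
  have hsucc : ∀ ω, walkPath X y ω (n + 1) = walkPath X y ω n + X n ω := fun ω => by
    simp only [walkPath, Finset.sum_range_succ, add_assoc]
  have hind : IndepFun U (X n) P := by
    have h := hindep.indepFun_finset₀ (Finset.range n) {n} (by simp) hX
    exact h.comp measurable_id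
      (measurable_pi_apply (⟨n, Finset.mem_singleton_self n⟩ : ({n} : Finset ℕ)))
  have hmap : P.map (fun ω => (U ω, X n ω)) = (P.map U).prod μ := by
    rw [(indepFun_iff_map_prod_eq_prod_map_map hU (hX n)).1 hind, (hlaw n).map_eq]
  let F : (Finset.range n → ℝ) × ℝ → ℝ≥0∞ := fun p => G (e p.1) * H (e p.1 n) (e p.1 n + p.2)
  have hen' : Measurable (fun p : (Finset.range n → ℝ) × ℝ => e p.1 n) :=
    (measurable_pi_apply n).comp (he.comp measurable_fst)
  have hF : Measurable F := (hG.comp (he.comp measurable_fst)).mul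
    (hH.comp (hen'.prodMk (hen'.add measurable_snd)))
  have hHs : ∀ x, Measurable (H x) := fun x => hH.comp (measurable_const.prodMk measurable_id)
  have hl : Measurable (fun s : ℕ → ℝ => G s * H (s n) (s (n + 1))) :=
    hG.mul (hH.comp (f := fun s : ℕ → ℝ => (s n, s (n + 1)))
      ((measurable_pi_apply n).prodMk (measurable_pi_apply (n + 1))))
  have hr : Measurable (fun s : ℕ → ℝ => G s * ∫⁻ z, H (s n) z ∂(walkKernel μ (s n))) := by
    have h1 : Measurable (fun x : ℝ => ∫⁻ z, H x z ∂(walkKernel μ x)) :=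
      Measurable.lintegral_kernel_prod_right' hH
    exact hG.mul (h1.comp (measurable_pi_apply n))
  calc ∫⁻ s, G s * H (s n) (s (n + 1)) ∂(P.map (walkPath X y))
      = ∫⁻ ω, F (U ω, X n ω) ∂P := by
        rw [lintegral_map' hl.aemeasurable hW]
        refine lintegral_congr fun ω => ?_
        simp only [F, heG, hen, hsucc]
    _ = ∫⁻ p, F p ∂((P.map U).prod μ) := by
        rw [← hmap, lintegral_map' hF.aemeasurable (hU.prodMk (hX n))]
    _ = ∫⁻ ω, ∫⁻ x, F (U ω, x) ∂μ ∂P := by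
        rw [lintegral_prod _ hF.aemeasurable,
          lintegral_map' hF.lintegral_prod_right'.aemeasurable hU]
    _ = ∫⁻ s, G s * ∫⁻ z, H (s n) z ∂(walkKernel μ (s n)) ∂(P.map (walkPath X y)) := by
        rw [lintegral_map' hr.aemeasurable hW]
        refine lintegral_congr fun ω => ?_
        simp only [F, heG, hen]
        have hHω : Measurable fun x => H (walkPath X y ω n) (walkPath X y ω n + x) :=
          (hHs _).comp (measurable_const_add _)
        rw [lintegral_walkKernel μ _ (hHs _), lintegral_const_mul _ hHω]

lemma lintegral_walk_zero [IsProbabilityMeasure P] (hX : ∀ n, AEMeasurable (X n) P) (y : ℝ)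
    {φ : ℝ → ℝ≥0∞} (hφ : Measurable φ) : ∫⁻ s, φ (s 0) ∂(P.map (walkPath X y)) = φ y := by
  rw [lintegral_map' (f := fun s : ℕ → ℝ => φ (s 0)) (hφ.comp (measurable_pi_apply 0)).aemeasurable
    (aemeasurable_walkPath hX y)]
  simp [walkPath]

end Walk

/-! ### Lower bound for the crossing probability by one big jump -/

lemma measure_crosses_eq_tsum (ν : Measure (ℕ → ℝ)) :
    ν crosses = ∑' n, weightedBelow ν (fun _ _ => 1) n ((Set.Ioi 0).indicator 1) := by
  rw [crosses_eq_iUnion, measure_iUnion disjoint_firstCross measurableSet_firstCross]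
  refine tsum_congr fun n => ?_
  rw [weightedBelow_indicator_Ioi]
  simp [lintegral_indicator (measurableSet_firstCross n)]

/-- A chain with the walk kernel makes a jump larger than `t` after any event of the past with
probability `μ (t, ∞)`. -/
lemma measure_inter_jump {ν : Measure (ℕ → ℝ)} {μ : Measure ℝ} [IsFiniteMeasure μ]
    (hν : IsMarkovChain ν (walkKernel μ)) (n : ℕ) {A : Set (ℕ → ℝ)} (hA : MeasurableSet A)
    (hAn : ∀ s : ℕ → ℝ, (fun k => s (min k n)) ∈ A ↔ s ∈ A) (t : ℝ) :
    ν (A ∩ {s | t < s (n + 1) - s n}) = ν A * μ (Set.Ioi t) := by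
  classical
  let H : ℝ → ℝ → ℝ≥0∞ := fun x z => (Set.Ioi t).indicator 1 (z - x)
  have hH : Measurable (Function.uncurry H) :=
    (measurable_one.indicator measurableSet_Ioi).comp (measurable_snd.sub measurable_fst)
  have hHs : ∀ x, Measurable (H x) := fun x => hH.comp (measurable_const.prodMk measurable_id)
  have key := hν n (A.indicator 1) H (measurable_one.indicator hA)
    (fun s => by simp only [Set.indicator_apply, hAn, Pi.one_apply]) hH
  have hB : MeasurableSet {s : ℕ → ℝ | t < s (n + 1) - s n} :=
    measurableSet_lt measurable_const
      ((measurable_pi_apply (X := fun _ : ℕ => ℝ) (n + 1)).sub (measurable_pi_apply n))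
  have hk : ∀ x, ∫⁻ z, H x z ∂(walkKernel μ x) = μ (Set.Ioi t) := by
    intro x
    rw [lintegral_walkKernel μ x (hHs x), ← lintegral_indicator_one measurableSet_Ioi]
    simp [H]
  simp only [hk] at key
  rw [lintegral_mul_const _ (measurable_one.indicator hA), lintegral_indicator_one hA] at key
  rw [← key, ← lintegral_indicator_one (hA.inter hB)]
  refine lintegral_congr fun s => ?_
  by_cases h1 : s ∈ A <;> by_cases h2 : t < s (n + 1) - s n <;> simp [H, h1, h2]

/-- Cut `(b, ∞)` into intervals of length `c` and bound the decreasing tail on each by its value at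
the left end. -/
lemma lintegral_tail_le_tsum (μ : Measure ℝ) (b : ℝ) {c : ℝ} (hc : 0 < c) :
    ∫⁻ s in Set.Ioi b, μ (Set.Ioi s) ≤
      ENNReal.ofReal c * ∑' n : ℕ, μ (Set.Ioi (b + c * n)) := by
  have hcov : Set.Ioi b ⊆ ⋃ n : ℕ, Set.Ico (b + c * n) (b + c * (n + 1)) := by
    intro x hx
    have hx' : 0 ≤ (x - b) / c := div_nonneg (sub_nonneg.2 (le_of_lt hx)) hc.le
    refine Set.mem_iUnion.2 ⟨⌊(x - b) / c⌋₊, ?_, ?_⟩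
    · have := (le_div_iff₀ hc).1 (Nat.floor_le hx')
      linarith
    · have := (div_lt_iff₀ hc).1 (Nat.lt_floor_add_one ((x - b) / c))
      linarith
  calc ∫⁻ s in Set.Ioi b, μ (Set.Ioi s)
      ≤ ∫⁻ s in ⋃ n : ℕ, Set.Ico (b + c * n) (b + c * (n + 1)), μ (Set.Ioi s) :=
        lintegral_mono_set hcov
    _ ≤ ∑' n : ℕ, ∫⁻ s in Set.Ico (b + c * n) (b + c * (n + 1)), μ (Set.Ioi s) :=
        lintegral_iUnion_le _ _
    _ ≤ ∑' n : ℕ, ENNReal.ofReal c * μ (Set.Ioi (b + c * n)) := by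
        refine ENNReal.tsum_le_tsum fun n => ?_
        calc ∫⁻ s in Set.Ico (b + c * n) (b + c * (n + 1)), μ (Set.Ioi s)
            ≤ ∫⁻ _ in Set.Ico (b + c * n) (b + c * (n + 1)), μ (Set.Ioi (b + c * n)) :=
              setLIntegral_mono' measurableSet_Ico fun s hs =>
                measure_mono (Set.Ioi_subset_Ioi hs.1)
          _ = ENNReal.ofReal c * μ (Set.Ioi (b + c * n)) := by
              rw [setLIntegral_const, Real.volume_Ico, mul_comm]
              congr 2
              ring
    _ = _ := ENNReal.tsum_mul_left

section LowerBound

variable {Ω : Type*} [MeasurableSpace Ω] {P : Measure Ω} {X : ℕ → Ω → ℝ}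

/-- Markov's inequality for the partial sums. -/
lemma measure_sum_lt_le {μ : Measure ℝ}
    (hlaw : ∀ n, HasLaw (X n) μ P) {c : ℝ} (hc : 0 < c)
    (hm : 4 * ∫⁻ x, ‖x‖ₑ ∂μ ≤ ENNReal.ofReal c) (n : ℕ) :
    P {ω | ∑ i ∈ Finset.range n, X i ω < -(c * n)} ≤ 4⁻¹ := by
  rcases Nat.eq_zero_or_pos n with rfl | hn
  · simp
  have hcn : 0 < c * n := mul_pos hc (Nat.cast_pos.2 hn)
  have hmeas : AEMeasurable (fun ω => ‖∑ i ∈ Finset.range n, X i ω‖ₑ) P :=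
    (Finset.aemeasurable_fun_sum _ fun i _ => (hlaw i).aemeasurable).enorm
  have hX : ∀ i, ∫⁻ ω, ‖X i ω‖ₑ ∂P = ∫⁻ x, ‖x‖ₑ ∂μ := fun i => by
    rw [← (hlaw i).map_eq, lintegral_map' measurable_enorm.aemeasurable (hlaw i).aemeasurable]
  -- Markov's inequality for `|S_n|`, with `E|S_n| ≤ n E|X|`; the hypothesis on `c` makes the right
  -- side at most `cn/4`.
  have h1 : ENNReal.ofReal (c * n) * P {ω | ∑ i ∈ Finset.range n, X i ω < -(c * n)} ≤
      n * ∫⁻ x, ‖x‖ₑ ∂μ := by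
    calc _ ≤ ENNReal.ofReal (c * n) *
          P {ω | ENNReal.ofReal (c * n) ≤ ‖∑ i ∈ Finset.range n, X i ω‖ₑ} := by
          refine mul_le_mul_right (measure_mono fun ω hω => ?_) _
          have hω' : ∑ i ∈ Finset.range n, X i ω < -(c * n) := hω
          change ENNReal.ofReal (c * n) ≤ ‖∑ i ∈ Finset.range n, X i ω‖ₑ
          rw [← ofReal_norm, Real.norm_eq_abs]
          refine ENNReal.ofReal_le_ofReal ?_
          have := neg_le_abs (∑ i ∈ Finset.range n, X i ω)
          linarith
      _ ≤ ∫⁻ ω, ‖∑ i ∈ Finset.range n, X i ω‖ₑ ∂P := mul_meas_ge_le_lintegral₀ hmeas _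
      _ ≤ ∫⁻ ω, ∑ i ∈ Finset.range n, ‖X i ω‖ₑ ∂P := lintegral_mono fun ω => enorm_sum_le _ _
      _ = ∑ i ∈ Finset.range n, ∫⁻ ω, ‖X i ω‖ₑ ∂P :=
          lintegral_finsetSum' _ fun i _ => (hlaw i).aemeasurable.enorm
      _ = n * ∫⁻ x, ‖x‖ₑ ∂μ := by simp [hX]
  have h2 : ENNReal.ofReal (c * n) * P {ω | ∑ i ∈ Finset.range n, X i ω < -(c * n)} ≤
      ENNReal.ofReal (c * n) * 4⁻¹ := by
    refine h1.trans ?_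
    rw [← div_eq_mul_inv, ENNReal.le_div_iff_mul_le (by simp) (by simp),
      ENNReal.ofReal_mul hc.le, ENNReal.ofReal_natCast]
    calc (n * ∫⁻ x, ‖x‖ₑ ∂μ) * 4 = (4 * ∫⁻ x, ‖x‖ₑ ∂μ) * n := by ring
      _ ≤ _ := by gcongr
  exact (ENNReal.mul_le_mul_iff_right (by simpa using hcn) ENNReal.ofReal_ne_top).1 h2

/-- A random walk with integrable increments exceeds the level `b` with a probability that is at
least of the order of the integrated tail at `b`. -/
lemma quarter_lt_or_lintegral_tail_le [IsProbabilityMeasure P] {μ : Measure ℝ}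
    [IsProbabilityMeasure μ] (hlaw : ∀ n, HasLaw (X n) μ P) (hindep : iIndepFun X P)
    {c : ℝ} (hc : 0 < c) (hm : 4 * ∫⁻ x, ‖x‖ₑ ∂μ ≤ ENNReal.ofReal c) (b : ℝ) :
    4⁻¹ < P.map (walkPath X (-b)) crosses ∨
      ∫⁻ s in Set.Ioi b, μ (Set.Ioi s) ≤
        ENNReal.ofReal c * (2 * P.map (walkPath X (-b)) crosses) := by
  have hX : ∀ n, AEMeasurable (X n) P := fun n => (hlaw n).aemeasurable
  have hW := aemeasurable_walkPath hX (-b)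
  set ν := P.map (walkPath X (-b)) with hν
  have hprob : IsProbabilityMeasure ν := Measure.isProbabilityMeasure_map hW
  refine or_iff_not_imp_left.2 fun hq => ?_
  have hq' : ν crosses ≤ 4⁻¹ := not_lt.1 hq
  -- The favourable past: no crossing up to and including time `n`, and a position from which a jump
  -- above `b + cn` must cross.
  let A : ℕ → Set (ℕ → ℝ) := fun n => below (n + 1) ∩ {s | -b - c * n ≤ s n}
  have hA : ∀ n, MeasurableSet (A n) := fun n => (measurableSet_below _).inter
    (measurableSet_le measurable_const (measurable_pi_apply n))
  have hAn : ∀ n (s : ℕ → ℝ), (fun k => s (min k n)) ∈ A n ↔ s ∈ A n := by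
    intro n s
    refine and_congr (forall_congr' fun k => forall_congr' fun hk => ?_) ?_
    · change s (min k n) ≤ 0 ↔ s k ≤ 0
      rw [min_eq_left (Nat.lt_succ_iff.1 hk)]
    · change -b - c * n ≤ s (min n n) ↔ -b - c * n ≤ s n
      rw [min_self]
  have hlow : ∀ n : ℕ, ν {s | s n < -b - c * n} ≤ 4⁻¹ := by
    intro n
    have hs : MeasurableSet {s : ℕ → ℝ | s n < -b - c * n} :=
      measurableSet_lt (measurable_pi_apply n) measurable_const
    rw [hν, Measure.map_apply_of_aemeasurable hW hs]
    refine (measure_mono fun ω hω => ?_).trans (measure_sum_lt_le hlaw hc hm n)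
    have hω' : -b + ∑ i ∈ Finset.range n, X i ω < -b - c * n := hω
    change ∑ i ∈ Finset.range n, X i ω < -(c * n)
    linarith
  -- Off `A n` the path either crosses at some time or is too low at time `n`; each has probability
  -- at most `1/4`.
  have hhalf : ∀ n, 1 ≤ 2 * ν (A n) := by
    intro n
    have hcov : (Set.univ : Set (ℕ → ℝ)) ⊆ A n ∪ (crosses ∪ {s | s n < -b - c * n}) := by
      intro s _
      by_cases h1 : s ∈ crosses
      · exact Or.inr (Or.inl h1)
      · by_cases h2 : s n < -b - c * n
        · exact Or.inr (Or.inr h2)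
        · exact Or.inl ⟨fun k _ => not_lt.1 fun h => h1 ⟨k, h⟩, not_lt.1 h2⟩
    have h1 : (1 : ℝ≥0∞) ≤ ν (A n) + (4⁻¹ + 4⁻¹) := by
      rw [← measure_univ (μ := ν)]
      exact (measure_mono hcov).trans ((measure_union_le _ _).trans
        (add_le_add_right ((measure_union_le _ _).trans (add_le_add hq' (hlow n))) _))
    have hne : ν (A n) ≠ ⊤ := measure_ne_top _ _
    have h2 := ENNReal.toReal_mono (by finiteness) h1
    rw [ENNReal.toReal_add hne (by finiteness), ENNReal.toReal_add (by finiteness) (by finiteness)]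
      at h2
    norm_num at h2
    rw [← ENNReal.toReal_le_toReal ENNReal.one_ne_top (by finiteness), ENNReal.toReal_mul]
    norm_num
    linarith
  have hsub : ∀ n : ℕ, A n ∩ {s | b + c * n < s (n + 1) - s n} ⊆ firstCross (n + 1) := by
    rintro n s ⟨⟨h1, h2⟩, h3⟩
    have h2' : -b - c * n ≤ s n := h2
    have h3' : b + c * n < s (n + 1) - s n := h3
    exact ⟨h1, show 0 < s (n + 1) by linarith⟩
  have hsum : ∑' n : ℕ, μ (Set.Ioi (b + c * n)) ≤ 2 * ν crosses := by
    calc ∑' n : ℕ, μ (Set.Ioi (b + c * n))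
        ≤ ∑' n : ℕ, 2 * ν (firstCross (n + 1)) := by
          refine ENNReal.tsum_le_tsum fun n => ?_
          calc μ (Set.Ioi (b + c * n)) ≤ (2 * ν (A n)) * μ (Set.Ioi (b + c * n)) :=
                le_mul_of_one_le_left zero_le (hhalf n)
            _ = 2 * ν (A n ∩ {s | b + c * n < s (n + 1) - s n}) := by
                rw [measure_inter_jump (isMarkovChain_walk hlaw hindep (-b)) n (hA n) (hAn n),
                  mul_assoc]
            _ ≤ _ := by
                gcongr
                exact hsub n
      _ = 2 * ∑' n : ℕ, ν (firstCross (n + 1)) := ENNReal.tsum_mul_left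
      _ ≤ 2 * ∑' n : ℕ, ν (firstCross n) := by
          refine mul_le_mul_right ?_ _
          exact ENNReal.tsum_comp_le_tsum_of_injective (add_left_injective 1)
            fun n => ν (firstCross n)
      _ = 2 * ν crosses := by
          rw [crosses_eq_iUnion, measure_iUnion disjoint_firstCross measurableSet_firstCross]
  exact (lintegral_tail_le_tsum μ b hc).trans (by gcongr)

end LowerBound

/-! ### Properties of `v` and `w`, and the second-moment bound -/

lemma ClassSStar.tail_pos_of_posPartLaw {μ : Measure ℝ} [IsFiniteMeasure μ]
    (hS : ClassSStar (posPartLaw μ)) (t : ℝ) : 0 < tail μ t := by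
  -- The tails of `X` and `X⁺` agree at nonnegative levels; below zero, monotonicity takes over.
  have h := hS.tail_pos (max t 0)
  have hmax : Measurable (fun x : ℝ => max x 0) := measurable_id.max measurable_const
  have heq : tail (posPartLaw μ) (max t 0) = tail μ (max t 0) := by
    unfold tail posPartLaw
    rw [map_measureReal_apply hmax measurableSet_Ioi]
    congr 1
    ext x
    change max t 0 < max x 0 ↔ max t 0 < x
    exact ⟨fun h => (lt_max_iff.1 h).resolve_right (not_lt.2 (le_max_right t 0)),
      fun h => h.trans_le (le_max_left x 0)⟩
  rw [heq] at h
  exact h.trans_le (antitone_tail μ (le_max_left t 0))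

section Weights

variable {μ : Measure ℝ} [IsProbabilityMeasure μ]

lemma v_eq_tail (y : ℝ) : v μ y = tail (zLaw μ) (-y) := rfl

/-- By monotonicity of `v` the infimum is attained at `z = 0`. -/
lemma kappa_eq_v (a : ℝ) : kappa μ a = v μ a := by
  have h0 : ∀ z : Set.Ici (0 : ℝ), v μ a ≤ v μ (z + a) := fun z =>
    monotone_v μ (by have := z.2; simp only [Set.mem_Ici] at this; linarith)
  refine le_antisymm ?_ (le_ciInf h0)
  have := ciInf_le (f := fun z : Set.Ici (0 : ℝ) => v μ (z + a))
    ⟨v μ a, by rintro _ ⟨z, rfl⟩; exact h0 z⟩ ⟨0, Set.self_mem_Ici⟩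
  simpa [kappa] using this

variable (hint : Integrable (fun x : ℝ => x) μ)
include hint

lemma v_eq_one {y : ℝ} (hy : 0 < y) : v μ y = 1 := by
  have := isProbabilityMeasure_zLaw μ hint
  have hz : (zLaw μ).real (Set.Iic (-y)) = 0 := by
    rw [measureReal_def, measure_mono_null (fun z hz => ?_) (zLaw_Iio μ), ENNReal.toReal_zero]
    exact lt_of_le_of_lt hz (neg_lt_zero.2 hy)
  have h := probReal_compl_eq_one_sub (μ := zLaw μ) (measurableSet_Iic (a := -y))
  rw [hz, Set.compl_Iic, sub_zero] at h
  exact h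

lemma v_le_one (y : ℝ) : v μ y ≤ 1 := by
  have := isProbabilityMeasure_zLaw μ hint
  exact measureReal_le_one

lemma ofReal_integral_tail (t : ℝ) :
    ENNReal.ofReal (∫ s in Set.Ioi t, tail μ s) = ∫⁻ s in Set.Ioi t, μ (Set.Ioi s) := by
  rw [ofReal_integral_eq_lintegral_ofReal
    (integrableOn_tail_Ioi μ (integrableOn_tail μ hint) t)
    (Filter.Eventually.of_forall fun s => tail_nonneg μ s)]
  refine lintegral_congr fun s => ?_
  rw [tail, ofReal_measureReal]

lemma v_pos (hneg : ∫ x, x ∂μ < 0) (htail : ∀ t, 0 < tail μ t) (y : ℝ) : 0 < v μ y := by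
  have h : ∀ t, 0 ≤ t → 0 < v μ (-t) := by
    intro t ht
    rw [v_eq_tail, neg_neg, tail_zLaw μ hint hneg ht]
    refine lt_min (mul_pos (neg_pos.2 (inv_lt_zero.2 hneg)) ?_) one_pos
    rw [setIntegral_pos_iff_support_of_nonneg_ae
      (Filter.Eventually.of_forall fun s => tail_nonneg μ s)
      (integrableOn_tail_Ioi μ (integrableOn_tail μ hint) t)]
    have : Function.support (tail μ) = Set.univ :=
      Set.eq_univ_of_forall fun s => (htail s).ne'
    rw [this, Set.univ_inter, Real.volume_Ioi]
    exact ENNReal.zero_lt_top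
  -- The explicit tail formula covers only nonnegative levels, so `v` is bounded below by its value
  -- at `-|y|`.
  have h1 := h |y| (abs_nonneg y)
  exact h1.trans_le (monotone_v μ (neg_abs_le y))

lemma integrable_v_add (y : ℝ) : Integrable (fun x => v μ (y + x)) μ :=
  Integrable.of_bound ((monotone_v μ).measurable.comp (measurable_const_add y)).aestronglyMeasurable
    1 (Filter.Eventually.of_forall fun x => by
      rw [Real.norm_of_nonneg (v_nonneg μ _)]
      exact v_le_one hint _)

lemma integral_v_add (y : ℝ) : ∫ x, v μ (y + x) ∂μ = w μ y := by
  have h := lintegral_v μ y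
  rw [← ofReal_integral_eq_lintegral_ofReal (integrable_v_add hint y)
    (Filter.Eventually.of_forall fun x => v_nonneg μ _)] at h
  exact (ENNReal.ofReal_eq_ofReal_iff (integral_nonneg fun x => v_nonneg μ _) (w_nonneg μ y)).1 h

/-- On `X > -y` the value `v (y + X)` is already `1`. In particular `w` is positive. -/
lemma tail_le_w (y : ℝ) : tail μ (-y) ≤ w μ y := by
  rw [← integral_v_add hint y, tail, ← integral_indicator_one measurableSet_Ioi]
  refine integral_mono ((integrable_const (1 : ℝ)).indicator measurableSet_Ioi)
    (integrable_v_add hint y) fun x => ?_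
  by_cases hx : -y < x
  · simp [hx, v_eq_one hint (show 0 < y + x by linarith)]
  · simpa [hx] using v_nonneg μ _

omit hint in
lemma lintegral_stepKernel {a x : ℝ} (hw : 0 < w μ (x + a)) {f : ℝ → ℝ≥0∞} (hf : Measurable f) :
    ∫⁻ z, f z ∂(stepKernel μ a x) =
      ∫⁻ u, ENNReal.ofReal (v μ (x + u + a) / w μ (x + a)) * f (x + u) ∂μ := by
  have hm : Measurable (fun z => ENNReal.ofReal (v μ (z + a) / w μ (x + a))) :=
    (((monotone_v μ).measurable.comp (measurable_id.add_const a)).div_const _).ennreal_ofReal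
  change ∫⁻ z, f z ∂(stepLaw μ a x) = _
  rw [stepLaw, if_neg hw.ne', lintegral_withDensity_eq_lintegral_mul _ hm hf,
    lintegral_map (hm.mul hf) (measurable_const_add x)]
  rfl

omit hint in
/-- The likelihood ratio turns the importance sampler into the original random walk. -/
lemma lintegral_ratio_mul (hv : ∀ y, 0 < v μ y) {a x : ℝ} (hw : 0 < w μ (x + a)) {f : ℝ → ℝ≥0∞}
    (hf : Measurable f) :
    ∫⁻ z, ENNReal.ofReal (ratio μ a x z) * f z ∂(stepKernel μ a x) = ∫⁻ u, f (x + u) ∂μ := by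
  have hr : Measurable fun z => ENNReal.ofReal (ratio μ a x z) :=
    ((measurable_ratio μ a).comp (f := fun z => (x, z))
      (measurable_const.prodMk measurable_id)).ennreal_ofReal
  have hrf : Measurable fun z => ENNReal.ofReal (ratio μ a x z) * f z := hr.mul hf
  rw [lintegral_stepKernel hw hrf]
  refine lintegral_congr fun u => ?_
  rw [← mul_assoc, ← ENNReal.ofReal_mul (div_nonneg (v_nonneg μ _) (w_nonneg μ _)), ratio,
    div_mul_div_cancel₀ hw.ne', div_self (hv _).ne', ENNReal.ofReal_one, one_mul]

-- This identity of one-step operators is the whole reason for unbiasedness. The power `1` matches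
-- the general exponent in `lintegral_estimator_pow`.
omit hint in
lemma stepOp_ratio (hv : ∀ y, 0 < v μ y) (hw : ∀ y, 0 < w μ y) (a : ℝ) {φ : ℝ → ℝ≥0∞}
    (hφ : Measurable φ) :
    stepOp (walkKernel μ) (fun _ _ => 1) φ =
      stepOp (stepKernel μ a) (fun x z => ENNReal.ofReal (ratio μ a x z) ^ 1) φ := by
  unfold stepOp
  congr 1
  funext x
  simp only [one_mul, pow_one]
  rw [lintegral_ratio_mul hv (hw _) hφ, lintegral_walkKernel μ x hφ]

/-- The Lyapunov inequality behind the bound on the second moment. -/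
lemma lintegral_ratio_sq_le (hv : ∀ y, 0 < v μ y) (htail : ∀ t, 0 < tail μ t)
    {γ : ℝ} (hγ : γ ∈ Set.Ioo (0 : ℝ) 1) {a : ℝ} (ha : a ≤ 0)
    (ha' : ∀ y ≤ a, -γ ≤ ((v μ y) ^ 2 - (w μ y) ^ 2) / (tail μ (-y) * w μ y))
    {h : ℝ → ℝ≥0∞} (hm : Measurable h) {A : ℝ} (hA : A = (1 - γ)⁻¹ * (v μ a ^ 2)⁻¹)
    (hle : ∀ z ≤ 0, h z = ENNReal.ofReal (A * v μ (z + a) ^ 2)) (hpos : ∀ z, 0 < z → h z = 1)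
    {x : ℝ} (hx : x ≤ 0) :
    ∫⁻ z, ENNReal.ofReal (ratio μ a x z) ^ 2 * h z ∂(stepKernel μ a x) ≤ h x := by
  have hw : ∀ y, 0 < w μ y := fun y => (htail (-y)).trans_le (tail_le_w hint y)
  have hγ1 : 0 < 1 - γ := sub_pos.2 hγ.2
  have hA0 : 0 < A := by
    rw [hA]
    exact mul_pos (inv_pos.2 hγ1) (inv_pos.2 (pow_pos (hv a) 2))
  set y := x + a with hy
  have hr : Measurable fun z => ENNReal.ofReal (ratio μ a x z) :=
    ((measurable_ratio μ a).comp (f := fun z => (x, z))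
      (measurable_const.prodMk measurable_id)).ennreal_ofReal
  -- One of the two ratio factors undoes the sampler's change of measure.
  have hchain : ∫⁻ z, ENNReal.ofReal (ratio μ a x z) ^ 2 * h z ∂(stepKernel μ a x) =
      ∫⁻ u, ENNReal.ofReal (ratio μ a x (x + u)) * h (x + u) ∂μ := by
    have hrh : Measurable fun z => ENNReal.ofReal (ratio μ a x z) * h z := hr.mul hm
    rw [← lintegral_ratio_mul hv (hw y) hrh]
    refine lintegral_congr fun z => ?_
    rw [sq, mul_assoc]
  -- A majorant with explicit mean. The subtracted indicator is the slack available where `v (y + u)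
  -- = 1`; it produces the term `γ P(X > -y)` of the hypothesis.
  let g : ℝ → ℝ := fun u => A * w μ y * (v μ (y + u) - γ * (Set.Ioi (-y)).indicator 1 u)
  have hind : Integrable ((Set.Ioi (-y)).indicator (1 : ℝ → ℝ)) μ :=
    (integrable_const (1 : ℝ)).indicator measurableSet_Ioi
  have hg : Integrable g μ := ((integrable_v_add hint y).sub (hind.const_mul γ)).const_mul _
  have hg0 : ∀ u, 0 ≤ g u := by
    intro u
    refine mul_nonneg (mul_nonneg hA0.le (hw y).le) ?_
    by_cases hu : -y < u
    · simp only [Set.indicator_of_mem (Set.mem_Ioi.2 hu), Pi.one_apply,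
        v_eq_one hint (show 0 < y + u by linarith)]
      linarith [hγ.2]
    · simpa [hu] using v_nonneg μ _
  have hgint : ∫ u, g u ∂μ = A * w μ y * (w μ y - γ * tail μ (-y)) := by
    simp only [g]
    rw [integral_const_mul, integral_sub (integrable_v_add hint y) (hind.const_mul γ),
      integral_const_mul, integral_v_add hint y, integral_indicator_one measurableSet_Ioi, tail]
  have hpt : ∀ u, ENNReal.ofReal (ratio μ a x (x + u)) * h (x + u) ≤ ENNReal.ofReal (g u) := by
    intro u
    have hyu : x + u + a = y + u := by rw [hy]; ring
    have hvu := hv (y + u)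
    rcases le_or_gt (x + u) 0 with hz | hz
    · have hu : ¬ -y < u := by
        rw [hy]
        linarith
      rw [hle _ hz, ← ENNReal.ofReal_mul (ratio_nonneg μ a _ _)]
      refine ENNReal.ofReal_le_ofReal (le_of_eq ?_)
      simp only [g, ratio, hyu, Set.indicator_of_notMem (s := Set.Ioi (-y)) hu, ← hy]
      field_simp
      ring
    · rw [hpos _ hz, mul_one]
      refine ENNReal.ofReal_le_ofReal ?_
      have hva : v μ a ≤ v μ (y + u) := monotone_v μ (by rw [hy]; linarith)
      have h1 : (1 - γ) * v μ (y + u) ≤ v μ (y + u) - γ * (Set.Ioi (-y)).indicator 1 u := by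
        by_cases hu : -y < u
        · simp only [Set.indicator_of_mem (Set.mem_Ioi.2 hu), Pi.one_apply,
            v_eq_one hint (show 0 < y + u by linarith)]
          linarith
        · simp only [Set.indicator_of_notMem (s := Set.Ioi (-y)) hu]
          nlinarith [hγ.1]
      -- After a crossing `y + u > a`, so `v (y + u)` is at least `κ`. This is where the factor
      -- `κ⁻²` in `A` comes from; `h1` accounts for `(1 - γ)⁻¹`.
      have h2 : 1 ≤ (v μ a ^ 2)⁻¹ * v μ (y + u) ^ 2 := by
        rw [← div_eq_inv_mul, one_le_div (pow_pos (hv a) 2)]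
        exact pow_le_pow_left₀ (hv a).le hva 2
      calc ratio μ a x (x + u) = w μ y * (v μ (y + u))⁻¹ * 1 := by
            rw [ratio, hyu, ← hy, div_eq_mul_inv, mul_one]
        _ ≤ w μ y * (v μ (y + u))⁻¹ * ((v μ a ^ 2)⁻¹ * v μ (y + u) ^ 2) :=
            mul_le_mul_of_nonneg_left h2 (mul_nonneg (hw y).le (inv_nonneg.2 hvu.le))
        _ = A * w μ y * ((1 - γ) * v μ (y + u)) := by
            rw [hA]
            field_simp
        _ ≤ g u := mul_le_mul_of_nonneg_left h1 (mul_nonneg hA0.le (hw y).le)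
  have hkey : w μ y * (w μ y - γ * tail μ (-y)) ≤ v μ y ^ 2 := by
    have h1 := (le_div_iff₀ (mul_pos (htail (-y)) (hw y))).1
      (ha' y (by rw [hy]; linarith))
    nlinarith
  rw [hchain, hle x hx]
  calc _ ≤ ∫⁻ u, ENNReal.ofReal (g u) ∂μ := lintegral_mono hpt
    _ = ENNReal.ofReal (A * w μ y * (w μ y - γ * tail μ (-y))) := by
        rw [← ofReal_integral_eq_lintegral_ofReal hg (Filter.Eventually.of_forall hg0), hgint]
    _ ≤ _ := by
        refine ENNReal.ofReal_le_ofReal ?_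
        rw [mul_assoc]
        exact mul_le_mul_of_nonneg_left hkey hA0.le

lemma lintegral_estimator_sq_le (hv : ∀ y, 0 < v μ y) (htail : ∀ t, 0 < tail μ t)
    {γ : ℝ} (hγ : γ ∈ Set.Ioo (0 : ℝ) 1) {a : ℝ} (ha : a ≤ 0)
    (ha' : ∀ y ≤ a, -γ ≤ ((v μ y) ^ 2 - (w μ y) ^ 2) / (tail μ (-y) * w μ y))
    {y : ℝ} (hy : y ≤ 0) :
    ∫⁻ s, ENNReal.ofReal (estimator μ a s ^ 2) ∂(pathLaw μ a y) ≤
      ENNReal.ofReal ((1 - γ)⁻¹ * (kappa μ a ^ 2)⁻¹ * v μ (y + a) ^ 2) := by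
  rw [kappa_eq_v]
  set A := (1 - γ)⁻¹ * (v μ a ^ 2)⁻¹ with hA
  let h : ℝ → ℝ≥0∞ := fun z => if z ≤ 0 then ENNReal.ofReal (A * v μ (z + a) ^ 2) else 1
  have hm : Measurable h := by
    refine Measurable.ite measurableSet_Iic ?_ measurable_const
    exact ((((monotone_v μ).measurable.comp (measurable_id.add_const a)).pow_const 2).const_mul
      A).ennreal_ofReal
  have hle : ∀ z ≤ 0, h z = ENNReal.ofReal (A * v μ (z + a) ^ 2) := fun z hz => if_pos hz
  have hpos : ∀ z, 0 < z → h z = 1 := fun z hz => if_neg (not_le.2 hz)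
  rw [lintegral_estimator_pow μ a _ two_ne_zero, ← hle y hy, ← lintegral_pathLaw_zero μ a y hm]
  exact tsum_weightedBelow_le (isMarkovChain_pathLaw μ a y)
    ((measurable_ratio μ a).ennreal_ofReal.pow_const 2) hm (fun z hz => (hpos z hz).ge)
    fun x hx => lintegral_ratio_sq_le hint hv htail hγ ha ha' hm hA hle hpos hx

end Weights

/-! ### Unbiasedness and strong efficiency -/

section Efficiency

variable {Ω : Type*} [MeasurableSpace Ω] {P : Measure Ω} [IsProbabilityMeasure P]
  {X : ℕ → Ω → ℝ} {μ : Measure ℝ} [IsProbabilityMeasure μ]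

omit [IsProbabilityMeasure P] in
lemma measure_lt_walkMax (hX : ∀ n, AEMeasurable (X n) P) (b : ℝ) :
    P {ω | (b : EReal) < walkMax X ω} = P.map (walkPath X (-b)) crosses := by
  rw [Measure.map_apply_of_aemeasurable (aemeasurable_walkPath hX _) measurableSet_crosses]
  congr 1
  ext ω
  exact lt_walkMax_iff X b ω

/-- Walk and weighted sampler start at the same point and share their one-step operator, so their
first-crossing series agree term by term. -/
lemma lintegral_estimator (hlaw : ∀ n, HasLaw (X n) μ P) (hindep : iIndepFun X P)
    (hv : ∀ y, 0 < v μ y) (hw : ∀ y, 0 < w μ y) (a b : ℝ) :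
    ∫⁻ s, ENNReal.ofReal (estimator μ a s) ∂(pathLaw μ a (-b)) =
      P {ω | (b : EReal) < walkMax X ω} := by
  have hX : ∀ n, AEMeasurable (X n) P := fun n => (hlaw n).aemeasurable
  have h := lintegral_estimator_pow μ a (pathLaw μ a (-b)) one_ne_zero
  simp only [pow_one (estimator μ a _)] at h
  rw [h, measure_lt_walkMax hX, measure_crosses_eq_tsum]
  refine tsum_congr fun n => ?_
  refine (weightedBelow_congr (isMarkovChain_walk hlaw hindep (-b))
    (isMarkovChain_pathLaw μ a (-b)) measurable_const
    ((measurable_ratio μ a).ennreal_ofReal.pow_const 1) (fun φ hφ => ?_)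
    (fun φ hφ => stepOp_ratio hv hw a hφ) n _ (measurable_one.indicator measurableSet_Ioi)).symm
  rw [lintegral_walk_zero hX _ hφ, lintegral_pathLaw_zero μ a _ hφ]

/-- The tail of `Z` is at most of the order of the tail of the maximum of the random walk. -/
lemma exists_ofReal_v_le (hlaw : ∀ n, HasLaw (X n) μ P) (hindep : iIndepFun X P)
    (hint : Integrable (fun x : ℝ => x) μ) (hneg : ∫ x, x ∂μ < 0) :
    ∃ C : ℝ≥0∞, C ≠ ⊤ ∧ ∀ b : ℝ, 0 ≤ b →
      ENNReal.ofReal (v μ (-b)) ≤ C * P {ω | (b : EReal) < walkMax X ω} := by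
  have hX : ∀ n, AEMeasurable (X n) P := fun n => (hlaw n).aemeasurable
  have hm : ∫⁻ x, ‖x‖ₑ ∂μ ≠ ⊤ := hint.hasFiniteIntegral.ne
  -- The added `1` makes positivity of `c` immediate.
  set c : ℝ := (4 * ∫⁻ x, ‖x‖ₑ ∂μ).toReal + 1 with hc
  have hc0 : 0 < c := by positivity
  have hmc : 4 * ∫⁻ x, ‖x‖ₑ ∂μ ≤ ENNReal.ofReal c := by
    rw [← ENNReal.ofReal_toReal (ENNReal.mul_ne_top (by simp) hm)]
    exact ENNReal.ofReal_le_ofReal (by rw [hc]; linarith)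
  -- One summand for each alternative of `quarter_lt_or_lintegral_tail_le`: `4` when the crossing
  -- probability exceeds `1/4`, the other for the big-jump bound.
  refine ⟨4 + ENNReal.ofReal (-(∫ x, x ∂μ)⁻¹) * (ENNReal.ofReal c * 2), by finiteness,
    fun b hb => ?_⟩
  have hv : v μ (-b) = min (-(∫ x, x ∂μ)⁻¹ * ∫ s in Set.Ioi b, tail μ s) 1 := by
    rw [v_eq_tail, neg_neg, tail_zLaw μ hint hneg hb]
  rw [measure_lt_walkMax hX, add_mul]
  rcases quarter_lt_or_lintegral_tail_le hlaw hindep hc0 hmc b with h | h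
  · refine le_trans ?_ le_self_add
    calc ENNReal.ofReal (v μ (-b)) ≤ 1 := by
          rw [← ENNReal.ofReal_one]
          exact ENNReal.ofReal_le_ofReal (v_le_one hint _)
      _ = 4 * 4⁻¹ := (ENNReal.mul_inv_cancel (by simp) (by simp)).symm
      _ ≤ _ := by gcongr
  · refine le_trans ?_ le_add_self
    calc ENNReal.ofReal (v μ (-b))
        ≤ ENNReal.ofReal (-(∫ x, x ∂μ)⁻¹ * ∫ s in Set.Ioi b, tail μ s) :=
          ENNReal.ofReal_le_ofReal (hv ▸ min_le_left _ _)
      _ = ENNReal.ofReal (-(∫ x, x ∂μ)⁻¹) * ∫⁻ s in Set.Ioi b, μ (Set.Ioi s) := by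
          rw [ENNReal.ofReal_mul (neg_nonneg.2 (inv_lt_zero.2 hneg).le),
            ofReal_integral_tail hint]
      _ ≤ _ := by
          rw [mul_assoc, mul_assoc]
          gcongr

/-- A bound of the order of `v (y + a) ^ 2` on the second moment makes the estimator strongly
efficient. -/
lemma stronglyEfficient_estimator (hlaw : ∀ n, HasLaw (X n) μ P) (hindep : iIndepFun X P)
    (hint : Integrable (fun x : ℝ => x) μ) (hneg : ∫ x, x ∂μ < 0)
    (hv : ∀ y, 0 < v μ y) (hw : ∀ y, 0 < w μ y) {a : ℝ} (ha : a ≤ 0) {A : ℝ} (hA : 0 ≤ A)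
    (hsq : ∀ y ≤ 0, ∫⁻ s, ENNReal.ofReal (estimator μ a s ^ 2) ∂(pathLaw μ a y) ≤
      ENNReal.ofReal (A * v μ (y + a) ^ 2)) :
    StronglyEfficient (fun b => pathLaw μ a (-b)) (fun _ => estimator μ a)
      (fun b => P {ω | (b : EReal) < walkMax X ω}) where
  measurable := fun _ _ => measurable_estimator μ a
  unbiased := fun b _ => by
    have h1 := lintegral_estimator hlaw hindep hv hw a b
    have h0 : ∀ᵐ s ∂(pathLaw μ a (-b)), 0 ≤ estimator μ a s :=
      Filter.Eventually.of_forall (estimator_nonneg μ a)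
    have hi : Integrable (estimator μ a) (pathLaw μ a (-b)) := by
      refine ⟨(measurable_estimator μ a).aestronglyMeasurable, ?_⟩
      rw [hasFiniteIntegral_iff_ofReal h0, h1]
      exact measure_lt_top _ _
    exact ⟨hi, by rw [ofReal_integral_eq_lintegral_ofReal hi h0, h1]⟩
  bounded := by
    obtain ⟨C, hC, hb⟩ := exists_ofReal_v_le hlaw hindep hint hneg
    refine lt_of_le_of_lt (iSup_le fun b => ?_)
      (ENNReal.mul_lt_top (ENNReal.ofReal_lt_top (r := A)) (ENNReal.pow_lt_top hC.lt_top (n := 2)))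
    have hb0 : (0 : ℝ) < b := b.2
    have hvb := hb b hb0.le
    have hp : P {ω | ((b : ℝ) : EReal) < walkMax X ω} ≠ 0 := by
      intro h
      rw [h, mul_zero] at hvb
      exact not_lt.2 hvb (ENNReal.ofReal_pos.2 (hv _))
    refine ENNReal.div_le_of_le_mul ?_
    calc ∫⁻ s, ENNReal.ofReal (estimator μ a s ^ 2) ∂(pathLaw μ a (-b))
        ≤ ENNReal.ofReal (A * v μ (-b + a) ^ 2) := hsq _ (neg_nonpos.2 hb0.le)
      _ ≤ ENNReal.ofReal (A * v μ (-b) ^ 2) := by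
          refine ENNReal.ofReal_le_ofReal (mul_le_mul_of_nonneg_left ?_ hA)
          exact pow_le_pow_left₀ (v_nonneg μ _) (monotone_v μ (by linarith)) 2
      _ = ENNReal.ofReal A * ENNReal.ofReal (v μ (-b)) ^ 2 := by
          rw [ENNReal.ofReal_mul hA, ENNReal.ofReal_pow (v_nonneg μ _)]
      _ ≤ ENNReal.ofReal A * (C * P {ω | ((b : ℝ) : EReal) < walkMax X ω}) ^ 2 := by gcongr
      _ = _ := by rw [mul_pow, mul_assoc]

end Efficiency

end TailIS

theorem theorem3 {Ω : Type*} [MeasurableSpace Ω] (P : Measure Ω) [IsProbabilityMeasure P]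
    (X : ℕ → Ω → ℝ) (μ : Measure ℝ) [IsProbabilityMeasure μ]
    (hlaw : ∀ n, HasLaw (X n) μ P) (hindep : iIndepFun X P)
    (hint : Integrable (fun x : ℝ => x) μ) (hneg : ∫ x, x ∂μ < 0)
    (hS : TailIS.ClassSStar (TailIS.posPartLaw μ))
    (γ : ℝ) (hγ : γ ∈ Set.Ioo (0 : ℝ) 1)
    (a : ℝ) (ha : a ≤ 0)
    (ha' : ∀ y ≤ a, -γ ≤
      ((TailIS.v μ y) ^ 2 - (TailIS.w μ y) ^ 2) / (TailIS.tail μ (-y) * TailIS.w μ y)) :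
    TailIS.kappa μ a = TailIS.tail (TailIS.zLaw μ) (-a) ∧
    0 < TailIS.kappa μ a ∧
    (∀ y ≤ 0,
      ∫⁻ s, ENNReal.ofReal (TailIS.estimator μ a s ^ 2) ∂(TailIS.pathLaw μ a y) ≤
        ENNReal.ofReal ((1 - γ)⁻¹ * (TailIS.kappa μ a ^ 2)⁻¹ * TailIS.v μ (y + a) ^ 2)) ∧
    TailIS.StronglyEfficient (fun b => TailIS.pathLaw μ a (-b)) (fun _ => TailIS.estimator μ a)
      (fun b => P {ω | (b : EReal) < TailIS.walkMax X ω}) := by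
  have htail := hS.tail_pos_of_posPartLaw
  have hv := TailIS.v_pos hint hneg htail
  have hw : ∀ y, 0 < TailIS.w μ y := fun y => (htail (-y)).trans_le (TailIS.tail_le_w hint y)
  have hsq : ∀ y : ℝ, y ≤ 0 → _ := fun y hy =>
    TailIS.lintegral_estimator_sq_le hint hv htail hγ ha ha' (y := y) hy
  have hκ := TailIS.kappa_eq_v (μ := μ) a
  refine ⟨hκ, hκ ▸ hv a, hsq, TailIS.stronglyEfficient_estimator hlaw hindep hint hneg hv hw ha
    (mul_nonneg (inv_nonneg.2 (sub_pos.2 hγ.2).le) (inv_nonneg.2 (sq_nonneg _))) hsq⟩
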